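/- Let $\varphi:\mathbf D^2\to[-\infty,\infty)$ be a plurisubharmonic function on the unit polydisk $\mathbf D^2=\{|z_1|<1,\ |z_2|<1\}\subset\mathbf C^2$, not identically $-\infty$, which is toric: $\varphi(z_1,z_2)=\varphi(|z_1|,|z_2|)$. Let $\widehat\varphi$ be the function on $\{t\in\mathbf R^2: t_1,t_2<0\}$ with $\varphi(z_1,z_2)=\widehat\varphi(\log|z_1|,\log|z_2|)$, and let the Newton convex body $P(\varphi)\subset\mathbf R^2_{\ge0}$ be the closure of the set of all $\lambda\in\mathbf R_{\ge0}^2$ for which there is a constant $C$ with $\lambda_1t_1+\lambda_2t_2\le\widehat\varphi(t)+C$ for all $t_1,t_2<0$. Put $x_0=\inf\{x:(x,y)\in P(\varphi)\}$ and $y_0=\inf\{y:(x,y)\in P(\varphi)\}$. For $c>0$ let $\mathcal J(c\varphi)_0$ be the ideal of all germs $u$ of holomorphic functions at the origin such that $|u|^2e^{-2c\varphi}$ is Lebesgue integrable near $0$. A real number $\alpha>0$ is a jumping number of $\varphi$ at $0$ if for some $\delta>0$ one has, for $c>0$, $\mathcal J(c\varphi)_0=\mathcal J(\alpha\varphi)_0$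 if and only if $c\in[\alpha,\alpha+\delta)$, and $\mathcal J((\alpha+\delta)\varphi)_0\subsetneq\mathcal J(\alpha\varphi)_0$. Let $\mathrm{Jump}(\varphi)_0$ be the set of jumping numbers of $\varphi$ at $0$; a cluster point of it is an accumulation point in $\mathbf R$. Then $\mathrm{Jump}(\varphi)_0$ has at least one cluster point if and only if at least one of the following holds: (1) $x_0>0$ and $\{(x_0,t):t\in\mathbf R\}\cap P(\varphi)=\emptyset$; (2) $y_0>0$ and $\{(t,y_0):t\in\mathbf R\}\cap P(\varphi)=\emptyset$. If there is a cluster point, there are infinitely many. Moreover, the set of cluster points of $\mathrm{Jump}(\varphi)_0$ is precisely $$\Big\{\tfrac km : k\in\mathbf Z_{>0},\ m\in S\Big\},$$ where $S=\{x_0 : \text{(1) holds}\}\cup\{y_0 : \text{(2) holds}\}$, that is, $S$ consists of $x_0$ if (1) holds, of $y_0$ if (2) holds, and of nothing else. -/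

import Mathlib

open Set Filter Topology MeasureTheory

noncomputable section

/-! ### Plurisubharmonic functions -/

/-- The integral over `[0, 2π]` of an extended-real function, as the integral of the positive part
minus the integral of the negative part. For functions bounded above on the interval (such as
upper semicontinuous ones without the value `⊤`) the first term is finite, so the value is a
well-defined element of `[-∞, ∞)`. -/
def circleIntegralEReal (v : ℝ → EReal) : EReal :=
  ((∫⁻ θ in Icc (0 : ℝ) (2 * Real.pi), (v θ).toENNReal : ENNReal) : EReal) -
    ((∫⁻ θ in Icc (0 : ℝ) (2 * Real.pi), (-(v θ)).toENNReal : ENNReal) : EReal)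

/-- Plurisubharmonic functions `φ : Ω → [-∞, ∞)` on a domain (connected open set) `Ω ⊆ ℂ²`:
upper semicontinuous, not identically `-∞`, and subharmonic on every complex line, i.e. for every
closed disc `{a + ζ b : |ζ| ≤ 1}` contained in `Ω` one has
`φ a ≤ (1 / 2π) ∫₀^{2π} φ (a + exp (i θ) b) dθ`.
The values of `φ` outside `Ω` play no role. -/
structure IsPsh (Ω : Set (ℂ × ℂ)) (φ : ℂ × ℂ → EReal) : Prop where
  usc : UpperSemicontinuousOn φ Ω
  lt_top : ∀ z ∈ Ω, φ z < ⊤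
  exists_ne_bot : ∃ z ∈ Ω, φ z ≠ ⊥
  sub_mean : ∀ a b : ℂ × ℂ, (∀ ζ : ℂ, ‖ζ‖ ≤ 1 → a + ζ • b ∈ Ω) →
    φ a ≤ ((1 / (2 * Real.pi) : ℝ) : EReal) *
      circleIntegralEReal (fun θ : ℝ => φ (a + Complex.exp (θ * Complex.I) • b))

/-- The unit polydisk `𝐃²` in `ℂ²`. -/
def unitPolydisk : Set (ℂ × ℂ) := {z | ‖z.1‖ < 1 ∧ ‖z.2‖ < 1}

/-- Toric psh functions on the unit polydisk: `φ (z₁, z₂) = φ (|z₁|, |z₂|)`. -/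
structure IsToricPsh (φ : ℂ × ℂ → EReal) : Prop where
  psh : IsPsh unitPolydisk φ
  toric : ∀ z ∈ unitPolydisk, φ z = φ ((‖z.1‖ : ℂ), (‖z.2‖ : ℂ))

/-! ### The Newton convex body -/

/-- The function `φ̂` on `ℝ₋²` with `φ (z₁, z₂) = φ̂ (log |z₁|, log |z₂|)`. -/
def logTransform (φ : ℂ × ℂ → EReal) (t : ℝ × ℝ) : EReal :=
  φ ((Real.exp t.1 : ℂ), (Real.exp t.2 : ℂ))

/-- The Newton convex body `P(φ)`: the closure of the set of all `lam ∈ ℝ_{≥0}²` such that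
`⟨lam, t⟩ ≤ φ̂ (t) + O(1)` on `ℝ₋²`. -/
def newtonBody (φ : ℂ × ℂ → EReal) : Set (ℝ × ℝ) :=
  closure {lam : ℝ × ℝ | 0 ≤ lam.1 ∧ 0 ≤ lam.2 ∧ ∃ C : ℝ, ∀ t : ℝ × ℝ, t.1 < 0 → t.2 < 0 →
    ((lam.1 * t.1 + lam.2 * t.2 : ℝ) : EReal) ≤ logTransform φ t + (C : EReal)}

/-- `x₀`, the infimum of the first projection of `P(φ)`. -/
def asymptoteX (φ : ℂ × ℂ → EReal) : ℝ := sInf (Prod.fst '' newtonBody φ)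

/-- `y₀`, the infimum of the second projection of `P(φ)`. -/
def asymptoteY (φ : ℂ × ℂ → EReal) : ℝ := sInf (Prod.snd '' newtonBody φ)

/-! ### Multiplier ideals -/

/-- The ring `𝒪_x` of germs at `x` of holomorphic functions on `ℂ²`. -/
def holGerm (x : ℂ × ℂ) : Subring (Germ (𝓝 x) ℂ) where
  carrier := {g | ∃ u : ℂ × ℂ → ℂ, AnalyticAt ℂ u x ∧ (u : Germ (𝓝 x) ℂ) = g}
  mul_mem' := by
    rintro _ _ ⟨u, hu, rfl⟩ ⟨v, hv, rfl⟩
    exact ⟨u * v, hu.mul hv, rfl⟩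
  one_mem' := ⟨fun _ => 1, analyticAt_const, rfl⟩
  add_mem' := by
    rintro _ _ ⟨u, hu, rfl⟩ ⟨v, hv, rfl⟩
    exact ⟨u + v, hu.add hv, rfl⟩
  zero_mem' := ⟨fun _ => 0, analyticAt_const, rfl⟩
  neg_mem' := by
    rintro _ ⟨u, hu, rfl⟩
    exact ⟨-u, hu.neg, rfl⟩

/-- `|u|² e^{-2ψ}`, with values in `[0, ∞]`. -/
def multDensity (ψ : ℂ × ℂ → EReal) (u : ℂ × ℂ → ℂ) (z : ℂ × ℂ) : ENNReal :=
  ‖u z‖ₑ ^ 2 * EReal.exp (-(2 * ψ z))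

/-- `|u|² e^{-2ψ}` is integrable with respect to Lebesgue measure in some neighbourhood of `x`. -/
def IsMultIntegrable (ψ : ℂ × ℂ → EReal) (x : ℂ × ℂ) (u : ℂ × ℂ → ℂ) : Prop :=
  ∃ U ∈ 𝓝 x, AEMeasurable (multDensity ψ u) (volume.restrict U) ∧
    ∫⁻ z in U, multDensity ψ u z < ⊤

theorem IsMultIntegrable.add {ψ : ℂ × ℂ → EReal} {x : ℂ × ℂ} {u v : ℂ × ℂ → ℂ}
    (hu : AnalyticAt ℂ u x) (hv : AnalyticAt ℂ v x)
    (hU : IsMultIntegrable ψ x u) (hV : IsMultIntegrable ψ x v) :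
    IsMultIntegrable ψ x (u + v) := by
  obtain ⟨U, hUx, hUm, hUi⟩ := hU
  obtain ⟨V, hVx, hVm, hVi⟩ := hV
  have hev : ∀ᶠ z in 𝓝 x, z ∈ U ∧ z ∈ V ∧ ContinuousAt u z ∧ ContinuousAt v z := by
    filter_upwards [hUx, hVx, hu.eventually_analyticAt, hv.eventually_analyticAt]
      with z h1 h2 h3 h4 using ⟨h1, h2, h3.continuousAt, h4.continuousAt⟩
  obtain ⟨W, hW, hWo, hxW⟩ := mem_nhds_iff.1 hev
  have hF := hUm.mono_measure (Measure.restrict_mono (fun z hz => (hW hz).1) le_rfl :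
    volume.restrict W ≤ volume.restrict U)
  have hG := hVm.mono_measure (Measure.restrict_mono (fun z hz => (hW hz).2.1) le_rfl :
    volume.restrict W ≤ volume.restrict V)
  have hum : AEMeasurable u (volume.restrict W) :=
    ContinuousOn.aemeasurable (fun z hz => (hW hz).2.2.1.continuousWithinAt) hWo.measurableSet
  have hvm : AEMeasurable v (volume.restrict W) :=
    ContinuousOn.aemeasurable (fun z hz => (hW hz).2.2.2.continuousWithinAt) hWo.measurableSet
  refine ⟨W, hWo.mem_nhds hxW, ?_, ?_⟩
  · have key : multDensity ψ (u + v) = fun z => ‖u z + v z‖ₑ ^ 2 *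
        ((multDensity ψ u z + multDensity ψ v z) / (‖u z‖ₑ ^ 2 + ‖v z‖ₑ ^ 2)) := by
      funext z
      by_cases h0 : ‖u z‖ₑ ^ 2 + ‖v z‖ₑ ^ 2 = 0
      · have h1 : u z = 0 := by simpa using (add_eq_zero.1 h0).1
        have h2 : v z = 0 := by simpa using (add_eq_zero.1 h0).2
        simp [multDensity, h1, h2]
      · have ht : ‖u z‖ₑ ^ 2 + ‖v z‖ₑ ^ 2 ≠ ⊤ := by simp
        simp only [multDensity, Pi.add_apply]
        rw [← add_mul, mul_comm (‖u z‖ₑ ^ 2 + ‖v z‖ₑ ^ 2), ENNReal.mul_div_cancel_right h0 ht]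
    rw [key]
    exact ((hum.add hvm).enorm.pow_const 2).mul
      ((hF.add hG).div ((hum.enorm.pow_const 2).add (hvm.enorm.pow_const 2)))
  · have hle : ∀ z, multDensity ψ (u + v) z ≤ 2 * (multDensity ψ u z + multDensity ψ v z) := by
      intro z
      simp only [multDensity, Pi.add_apply]
      rw [← add_mul, ← mul_assoc]
      gcongr
      refine (pow_le_pow_left' (enorm_add_le _ _) 2).trans ?_
      have := add_sq_le (a := ‖u z‖) (b := ‖v z‖)
      rw [← ofReal_norm, ← ofReal_norm, ← ENNReal.ofReal_add (norm_nonneg _) (norm_nonneg _),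
        ← ENNReal.ofReal_pow (by positivity), ← ENNReal.ofReal_pow (by positivity),
        ← ENNReal.ofReal_pow (by positivity), ← ENNReal.ofReal_add (by positivity) (by positivity),
        ← ENNReal.ofReal_ofNat 2, ← ENNReal.ofReal_mul (by positivity)]
      exact ENNReal.ofReal_le_ofReal this
    calc ∫⁻ z in W, multDensity ψ (u + v) z
        ≤ ∫⁻ z in W, 2 * (multDensity ψ u z + multDensity ψ v z) := lintegral_mono hle
      _ = 2 * ((∫⁻ z in W, multDensity ψ u z) + ∫⁻ z in W, multDensity ψ v z) := by
          rw [lintegral_const_mul' _ _ (by simp), lintegral_add_left' hF]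
      _ < ⊤ := by
          refine ENNReal.mul_lt_top (by simp) (ENNReal.add_lt_top.2 ⟨?_, ?_⟩)
          · exact (lintegral_mono_set fun z hz => (hW hz).1).trans_lt hUi
          · exact (lintegral_mono_set fun z hz => (hW hz).2.1).trans_lt hVi

theorem IsMultIntegrable.mul_left {ψ : ℂ × ℂ → EReal} {x : ℂ × ℂ} {h u : ℂ × ℂ → ℂ}
    (hh : AnalyticAt ℂ h x) (hU : IsMultIntegrable ψ x u) :
    IsMultIntegrable ψ x (h * u) := by
  obtain ⟨U, hUx, hUm, hUi⟩ := hU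
  have hb : ∀ᶠ z in 𝓝 x, ‖h z‖ₑ < ‖h x‖ₑ + 1 :=
    hh.continuousAt.enorm.eventually_lt_const (ENNReal.lt_add_right (by simp) (by simp))
  have hev : ∀ᶠ z in 𝓝 x, z ∈ U ∧ ContinuousAt h z ∧ ‖h z‖ₑ < ‖h x‖ₑ + 1 := by
    filter_upwards [hUx, hh.eventually_analyticAt, hb]
      with z h1 h2 h3 using ⟨h1, h2.continuousAt, h3⟩
  obtain ⟨W, hW, hWo, hxW⟩ := mem_nhds_iff.1 hev
  have hF := hUm.mono_measure (Measure.restrict_mono (fun z hz => (hW hz).1) le_rfl :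
    volume.restrict W ≤ volume.restrict U)
  have hhm : AEMeasurable h (volume.restrict W) :=
    ContinuousOn.aemeasurable (fun z hz => (hW hz).2.1.continuousWithinAt) hWo.measurableSet
  have key : multDensity ψ (h * u) = fun z => ‖h z‖ₑ ^ 2 * multDensity ψ u z := by
    funext z
    simp [multDensity, mul_pow, mul_assoc]
  refine ⟨W, hWo.mem_nhds hxW, ?_, ?_⟩
  · rw [key]
    exact (hhm.enorm.pow_const 2).mul hF
  · rw [key]
    calc ∫⁻ z in W, ‖h z‖ₑ ^ 2 * multDensity ψ u z
        ≤ ∫⁻ z in W, (‖h x‖ₑ + 1) ^ 2 * multDensity ψ u z := by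
          refine setLIntegral_mono' hWo.measurableSet fun z hz => ?_
          have := (hW hz).2.2.le
          gcongr
      _ = (‖h x‖ₑ + 1) ^ 2 * ∫⁻ z in W, multDensity ψ u z :=
          lintegral_const_mul' _ _ (by simp)
      _ < ⊤ := ENNReal.mul_lt_top (ENNReal.pow_lt_top (by simp))
          ((lintegral_mono_set fun z hz => (hW hz).1).trans_lt hUi)

/-- The stalk `𝒥(ψ)_x` of the multiplier ideal sheaf: the ideal of all germs `u ∈ 𝒪_x` such that
`|u|² e^{-2ψ}` is integrable near `x`. -/
def multiplierIdeal (ψ : ℂ × ℂ → EReal) (x : ℂ × ℂ) : Ideal (holGerm x) where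
  carrier := {g | ∃ u : ℂ × ℂ → ℂ, AnalyticAt ℂ u x ∧ (u : Germ (𝓝 x) ℂ) = g ∧
    IsMultIntegrable ψ x u}
  add_mem' := by
    rintro ⟨_, _⟩ ⟨_, _⟩ ⟨u, hu, rfl, hui⟩ ⟨v, hv, rfl, hvi⟩
    exact ⟨u + v, hu.add hv, rfl, hui.add hu hv hvi⟩
  zero_mem' := ⟨0, analyticAt_const, rfl, univ, univ_mem, by
    have h : multDensity ψ 0 = fun _ => 0 := by
      funext z
      simp [multDensity]
    simp [h]⟩
  smul_mem' := by
    rintro ⟨_, h, hh, rfl⟩ ⟨_, _⟩ ⟨u, hu, rfl, hui⟩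
    exact ⟨h * u, hh.mul hu, rfl, hui.mul_left hh⟩

/-! ### Jumping numbers and their cluster points -/

/-- `𝒥(c φ)_x`. -/
def scaledMultiplierIdeal (φ : ℂ × ℂ → EReal) (x : ℂ × ℂ) (c : ℝ) : Ideal (holGerm x) :=
  multiplierIdeal (fun z => (c : EReal) * φ z) x

/-- The set `Jump(φ)_x` of jumping numbers at `x`: those `α > 0` such that, for some `δ > 0`,
`𝒥(c φ)_x` agrees with `𝒥(α φ)_x` precisely for `c ∈ [α, α + δ)`, and
`𝒥((α + δ) φ)_x ⊊ 𝒥(α φ)_x`. -/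
def jumpingNumbers (φ : ℂ × ℂ → EReal) (x : ℂ × ℂ) : Set ℝ :=
  {α | 0 < α ∧ ∃ δ : ℝ, 0 < δ ∧
    (∀ c : ℝ, 0 < c →
      (scaledMultiplierIdeal φ x c = scaledMultiplierIdeal φ x α ↔ c ∈ Ico α (α + δ))) ∧
    scaledMultiplierIdeal φ x (α + δ) < scaledMultiplierIdeal φ x α}

/-- The set of cluster points (limit points, i.e. accumulation points in `ℝ`) of a set of reals. -/
def clusterPoints (J : Set ℝ) : Set ℝ := {c | AccPt c (𝓟 J)}

/-- The condition that `x₀ > 0` and the vertical line `x = x₀` does not meet `P(φ)`. -/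
def VerticalCondition (φ : ℂ × ℂ → EReal) : Prop :=
  0 < asymptoteX φ ∧ {p : ℝ × ℝ | p.1 = asymptoteX φ} ∩ newtonBody φ = ∅

/-- The condition that `y₀ > 0` and the horizontal line `y = y₀` does not meet `P(φ)`. -/
def HorizontalCondition (φ : ℂ × ℂ → EReal) : Prop :=
  0 < asymptoteY φ ∧ {p : ℝ × ℝ | p.2 = asymptoteY φ} ∩ newtonBody φ = ∅

/-- The set `S` consisting of `x₀` if the vertical condition holds, and of `y₀` if the horizontal one
holds. -/
def asymptoteSet (φ : ℂ × ℂ → EReal) : Set ℝ :=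
  {m | (m = asymptoteX φ ∧ VerticalCondition φ) ∨ (m = asymptoteY φ ∧ HorizontalCondition φ)}

end

/-! In logarithmic coordinates a toric psh function becomes a finite convex function `hat φ` on the
open negative quadrant, nondecreasing in each variable. Convexity is obtained by touching: if the
function rose above a chord, a paraboloid strictly concave along that chord would touch it from
above, and the sub-mean inequality on a small disc rules this out (`IsToricPsh.not_touched`,
`IsToricPsh.logTransform_le_of_lt`).

Since the weight is invariant under the torus, averaging over roots of unity shows that each
multiplier ideal is determined by its monomials (`IsToricPsh.scaledMultiplierIdeal_le_iff`).
Integrating over products of annuli gives a criterion of Howald type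
(`IsToricPsh.isMultIntegrable_monom_iff`): `z₁^a z₂^b` belongs to the ideal at `c` iff `(a+1,
b+1)/c` stays in the set of linear minorants after a small diagonal move towards the origin.
Equivalently, `c` lies strictly below a threshold τ(a, b).

Hence the jumping numbers contain all thresholds and lie in the closure of the set of thresholds, so
both sets have the same accumulation points. Now τ is monotone in `a` and in `b` and exceeds any
given bound once both are large. An accumulation point therefore comes from a single row or a single
column, that is, from a bounded monotone sequence that does not attain its supremum. When `b` tends
to infinity only the first coordinate matters: the supremum of row `a` is `(a+1)/x₀`
(`IsUpperBody.isLUB_row_iff`), and it is attained iff the line `x = x₀` meets the Newton body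
(`IsUpperBody.mem_row_iff`). Columns follow by symmetry. If there is no minorant, or if the origin
lies in the Newton body, all the ideals coincide and both sides of the formula are empty. -/

noncomputable section

/-! ### Log-convexity of toric plurisubharmonic functions -/

theorem circleIntegralEReal_mono {v w : ℝ → EReal} (h : ∀ θ, v θ ≤ w θ) :
    circleIntegralEReal v ≤ circleIntegralEReal w := by
  unfold circleIntegralEReal
  refine EReal.sub_le_sub ?_ ?_
  · exact_mod_cast lintegral_mono fun θ => EReal.toENNReal_le_toENNReal (h θ)
  · exact_mod_cast lintegral_mono fun θ =>
      EReal.toENNReal_le_toENNReal (EReal.neg_le_neg_iff.2 (h θ))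

theorem circleIntegralEReal_coe {g : ℝ → ℝ} (hg : Continuous g) :
    circleIntegralEReal (fun θ => (g θ : EReal)) =
      ((∫ θ in Icc (0 : ℝ) (2 * Real.pi), g θ : ℝ) : EReal) := by
  have hi : IntegrableOn g (Icc (0 : ℝ) (2 * Real.pi)) := hg.continuousOn.integrableOn_Icc
  have h1 : ∫⁻ θ in Icc (0 : ℝ) (2 * Real.pi), ENNReal.ofReal (g θ) ≠ ⊤ := by
    have := hi.2
    refine ne_of_lt (lt_of_le_of_lt (lintegral_mono fun θ => ?_) this)
    exact Real.ofReal_le_enorm _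
  have h2 : ∫⁻ θ in Icc (0 : ℝ) (2 * Real.pi), ENNReal.ofReal (-g θ) ≠ ⊤ := by
    have := hi.neg.2
    refine ne_of_lt (lt_of_le_of_lt (lintegral_mono fun θ => ?_) this)
    exact Real.ofReal_le_enorm _
  rw [integral_eq_lintegral_pos_part_sub_lintegral_neg_part hi]
  unfold circleIntegralEReal
  have e1 : ∀ θ, ((g θ : EReal)).toENNReal = ENNReal.ofReal (g θ) := fun θ =>
    EReal.toENNReal_of_ne_top (EReal.coe_ne_top _)
  have e2 : ∀ θ, (-(g θ : EReal)).toENNReal = ENNReal.ofReal (-g θ) := fun θ => by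
    rw [← EReal.coe_neg]
    exact EReal.toENNReal_of_ne_top (EReal.coe_ne_top _)
  simp only [e1, e2]
  rw [EReal.coe_sub, EReal.coe_ennreal_toReal h1, EReal.coe_ennreal_toReal h2]

/-- Real part of `log (1 + w) = w + O(|w|²)` for `w = d e^{iθ}`; the bound `|d| ≤ 1/2` brings the
constant down to `1`. -/
theorem log_norm_one_add_sub_le {d θ : ℝ} (h : |d| ≤ 1 / 2) :
    |Real.log ‖1 + (d : ℂ) * Complex.exp (θ * Complex.I)‖ - d * Real.cos θ| ≤ d ^ 2 := by
  set w : ℂ := (d : ℂ) * Complex.exp (θ * Complex.I) with hw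
  have hn : ‖w‖ = |d| := by
    rw [hw, norm_mul, Complex.norm_exp_ofReal_mul_I, mul_one, Complex.norm_real, Real.norm_eq_abs]
  have hre : w.re = d * Real.cos θ := by
    rw [hw, Complex.re_ofReal_mul, Complex.exp_ofReal_mul_I_re]
  have := Complex.norm_log_one_add_sub_self_le (z := w) (by rw [hn]; linarith)
  have h3 : |(Complex.log (1 + w) - w).re| ≤ _ := (Complex.abs_re_le_norm _).trans this
  rw [Complex.sub_re, Complex.log_re, hre, hn, sq_abs] at h3
  refine h3.trans ?_
  have h4 : (1 - |d|)⁻¹ ≤ 2 := by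
    rw [inv_le_comm₀ (by linarith) (by norm_num)]
    linarith
  nlinarith [sq_nonneg d]

theorem norm_one_add_pos {d θ : ℝ} (h : |d| ≤ 1 / 2) :
    0 < ‖1 + (d : ℂ) * Complex.exp (θ * Complex.I)‖ := by
  rw [norm_pos_iff]
  intro h0
  have h1 : (d : ℂ) * Complex.exp (θ * Complex.I) = -1 := by linear_combination h0
  have h2 := congrArg norm h1
  rw [norm_mul, Complex.norm_exp_ofReal_mul_I, mul_one, Complex.norm_real, Real.norm_eq_abs,
    norm_neg, norm_one] at h2
  linarith

theorem continuous_log_norm_one_add {d : ℝ} (h : |d| ≤ 1 / 2) :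
    Continuous fun θ : ℝ => Real.log ‖1 + (d : ℂ) * Complex.exp (θ * Complex.I)‖ :=
  Continuous.log (by fun_prop) fun θ => (norm_one_add_pos h).ne'

/-- The function `log |1 + ζ|` is harmonic in the unit disc and vanishes at the centre. This removes
the linear part of a paraboloid from circle means. -/
theorem integral_log_norm_one_add {d : ℝ} (h : |d| ≤ 1 / 2) :
    ∫ θ in Icc (0 : ℝ) (2 * Real.pi), Real.log ‖1 + (d : ℂ) * Complex.exp (θ * Complex.I)‖ = 0 := by
  rcases eq_or_ne d 0 with rfl | hd
  · simp
  have := circleAverage_log_norm_sub_const_eq_log_radius_add_posLog (a := -1) (c := 0) hd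
  rw [Real.circleAverage_def] at this
  rw [integral_Icc_eq_integral_Ioc, ← intervalIntegral.integral_of_le (by positivity)]
  have hp : Real.posLog (d⁻¹ * ‖(0 : ℂ) - -1‖) = Real.posLog (d⁻¹) := by simp
  have hl : Real.log d + Real.posLog (d⁻¹) = 0 := by
    rw [← Real.posLog_abs, abs_inv, Real.posLog_eq_log_max_one (by positivity),
      max_eq_right, Real.log_inv, Real.log_abs]
    · ring
    · rw [one_le_inv₀ (by positivity)]
      linarith
  rw [hp, hl] at this
  simp only [circleMap_zero, sub_neg_eq_add, smul_eq_mul, mul_eq_zero, inv_eq_zero] at this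
  have := this.resolve_left (by simp [Real.pi_ne_zero])
  simpa only [add_comm] using this

theorem integral_cos_sq_circle : ∫ θ in Icc (0 : ℝ) (2 * Real.pi), Real.cos θ ^ 2 = Real.pi := by
  rw [integral_Icc_eq_integral_Ioc, ← intervalIntegral.integral_of_le (by positivity),
    integral_cos_sq]
  simp

theorem IsToricPsh.eq_logTransform {φ : ℂ × ℂ → EReal} (hφ : IsToricPsh φ) {z : ℂ × ℂ}
    (hz : z ∈ unitPolydisk) (h1 : z.1 ≠ 0) (h2 : z.2 ≠ 0) :
    φ z = logTransform φ (Real.log ‖z.1‖, Real.log ‖z.2‖) := by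
  rw [hφ.toric z hz, logTransform]
  simp only
  rw [Real.exp_log (norm_pos_iff.2 h1), Real.exp_log (norm_pos_iff.2 h2)]

/-- The displacement is `e c d` plus an error of order `e²`. The concave square sees the main part,
the transverse square only the error; `(x + y)² ≥ x²/2 - y²` keeps half of the concave gain at the
cost of a term of order `e⁴`. -/
theorem concave_paraboloid_le {d : ℝ × ℝ} {κ k e x1 x2 c : ℝ} (hκ : 0 < κ) (hk : 0 ≤ k)
    (r1 : |x1| ≤ e ^ 2 * (|d.1| + |d.2|) ^ 2) (r2 : |x2| ≤ e ^ 2 * (|d.1| + |d.2|) ^ 2) :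
    -κ * (d.1 * (e * d.1 * c + x1) + d.2 * (e * d.2 * c + x2)) ^ 2
      + k * (d.1 * (e * d.2 * c + x2) - d.2 * (e * d.1 * c + x1)) ^ 2
      ≤ -(κ * e ^ 2 * (d.1 ^ 2 + d.2 ^ 2) ^ 2 / 2 * c ^ 2)
        + (κ + k) * e ^ 4 * (|d.1| + |d.2|) ^ 6 := by
  set D := |d.1| + |d.2| with hD
  have b1 : |d.1 * x1 + d.2 * x2| ≤ e ^ 2 * D ^ 3 := by
    calc |d.1 * x1 + d.2 * x2| ≤ |d.1| * |x1| + |d.2| * |x2| := by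
          rw [← abs_mul, ← abs_mul]; exact abs_add_le _ _
      _ ≤ |d.1| * (e ^ 2 * D ^ 2) + |d.2| * (e ^ 2 * D ^ 2) := by gcongr
      _ = e ^ 2 * D ^ 3 := by rw [hD]; ring
  have b2 : |d.1 * x2 - d.2 * x1| ≤ e ^ 2 * D ^ 3 := by
    calc |d.1 * x2 - d.2 * x1| ≤ |d.1| * |x2| + |d.2| * |x1| := by
          rw [← abs_mul, ← abs_mul]; exact abs_sub _ _
      _ ≤ |d.1| * (e ^ 2 * D ^ 2) + |d.2| * (e ^ 2 * D ^ 2) := by gcongr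
      _ = e ^ 2 * D ^ 3 := by rw [hD]; ring
  have q1 : (d.1 * x1 + d.2 * x2) ^ 2 ≤ e ^ 4 * D ^ 6 := by
    calc _ = |d.1 * x1 + d.2 * x2| ^ 2 := (sq_abs _).symm
      _ ≤ (e ^ 2 * D ^ 3) ^ 2 := by gcongr
      _ = _ := by ring
  have q2 : (d.1 * x2 - d.2 * x1) ^ 2 ≤ e ^ 4 * D ^ 6 := by
    calc _ = |d.1 * x2 - d.2 * x1| ^ 2 := (sq_abs _).symm
      _ ≤ (e ^ 2 * D ^ 3) ^ 2 := by gcongr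
      _ = _ := by ring
  have s1 : d.1 * (e * d.1 * c + x1) + d.2 * (e * d.2 * c + x2)
      = e * (d.1 ^ 2 + d.2 ^ 2) * c + (d.1 * x1 + d.2 * x2) := by ring
  have s2 : d.1 * (e * d.2 * c + x2) - d.2 * (e * d.1 * c + x1) = d.1 * x2 - d.2 * x1 := by ring
  have s3 : ∀ x y : ℝ, x ^ 2 / 2 - y ^ 2 ≤ (x + y) ^ 2 := fun x y => by
    nlinarith [sq_nonneg (x + 2 * y)]
  have s4 := s3 (e * (d.1 ^ 2 + d.2 ^ 2) * c) (d.1 * x1 + d.2 * x2)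
  rw [s1, s2]
  have t1 := mul_le_mul_of_nonneg_left s4 hκ.le
  have t2 := mul_le_mul_of_nonneg_left q1 hκ.le
  have t3 := mul_le_mul_of_nonneg_left q2 hk
  nlinarith [t1, t2, t3]

set_option maxHeartbeats 1000000 in
/-- A paraboloid that is strictly concave in the direction `d` does not touch the logarithmic
transform of a toric plurisubharmonic function from above. -/
theorem IsToricPsh.not_touched {φ : ℂ × ℂ → EReal} (hφ : IsToricPsh φ) {p d : ℝ × ℝ}
    (hp1 : p.1 < 0) (hp2 : p.2 < 0) (hd : d ≠ 0) {F l1 l2 κ k : ℝ} (hκ : 0 < κ) (hk : 0 ≤ k)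
    (hF : logTransform φ p = (F : EReal))
    (hn : ∀ᶠ t in 𝓝 p, logTransform φ t ≤ ((F + l1 * (t.1 - p.1) + l2 * (t.2 - p.2)
      - κ * (d.1 * (t.1 - p.1) + d.2 * (t.2 - p.2)) ^ 2
      + k * (d.1 * (t.2 - p.2) - d.2 * (t.1 - p.1)) ^ 2 : ℝ) : EReal)) : False := by
  set D := |d.1| + |d.2| with hD
  have hd2 : 0 < d.1 ^ 2 + d.2 ^ 2 := by
    rcases not_and_or.1 (fun h : d.1 = 0 ∧ d.2 = 0 => hd (Prod.ext h.1 h.2)) with h | h <;> positivity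
  obtain ⟨ρ, hρ, hball⟩ := Metric.eventually_nhds_iff.1 hn
  have ev : ∀ {g : ℝ → ℝ}, Continuous g → g 0 < 0 → ∀ᶠ e in 𝓝[>] (0 : ℝ), g e < 0 :=
    fun hg h0 => (hg.continuousAt.eventually_lt_const h0).filter_mono nhdsWithin_le_nhds
  -- The size `e` keeps the disc in the polydisk and its logarithmic image in the neighbourhood; by
  -- the last condition the concave gain of order `e²` beats the error of order `e⁴`.
  obtain ⟨e, he, e1, e2, e3, e4, e5, e6, e7⟩ : ∃ e : ℝ, 0 < e ∧ e * |d.1| - 1 / 2 < 0 ∧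
      e * |d.2| - 1 / 2 < 0 ∧ e * D + (e * D) ^ 2 - ρ < 0 ∧
      e * D - 1 < 0 ∧
      Real.exp p.1 * (1 + e * D) - 1 < 0 ∧ Real.exp p.2 * (1 + e * D) - 1 < 0 ∧
      (κ + k) * e ^ 2 * D ^ 6 - κ * (d.1 ^ 2 + d.2 ^ 2) ^ 2 / 4 < 0 := by
    have := (eventually_mem_nhdsWithin (s := Ioi (0:ℝ)) (a := 0)).and <|
      (ev (g := fun e => e * |d.1| - 1 / 2) (by fun_prop) (by norm_num)).and <|
      (ev (g := fun e => e * |d.2| - 1 / 2) (by fun_prop) (by norm_num)).and <|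
      (ev (g := fun e => e * D + (e * D) ^ 2 - ρ) (by fun_prop) (by simpa using hρ)).and <|
      (ev (g := fun e => e * D - 1) (by fun_prop) (by norm_num)).and <|
      (ev (g := fun e => Real.exp p.1 * (1 + e * D) - 1) (by fun_prop)
        (by simpa using hp1)).and <|
      (ev (g := fun e => Real.exp p.2 * (1 + e * D) - 1) (by fun_prop)
        (by simpa using hp2)).and
      (ev (g := fun e => (κ + k) * e ^ 2 * D ^ 6 - κ * (d.1 ^ 2 + d.2 ^ 2) ^ 2 / 4) (by fun_prop)
        (by simp; positivity))
    exact this.exists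
  have hD1 : |d.1| ≤ D := by simp [hD]
  have hD2 : |d.2| ≤ D := by simp [hD]
  have hD0 : 0 ≤ D := by positivity
  have a1 : |e * d.1| ≤ 1 / 2 := by rw [abs_mul, abs_of_pos he]; linarith
  have a2 : |e * d.2| ≤ 1 / 2 := by rw [abs_mul, abs_of_pos he]; linarith
  set h1 : ℝ → ℝ := fun θ => Real.log ‖1 + ((e * d.1 : ℝ) : ℂ) * Complex.exp (θ * Complex.I)‖ with hh1
  set h2 : ℝ → ℝ := fun θ => Real.log ‖1 + ((e * d.2 : ℝ) : ℂ) * Complex.exp (θ * Complex.I)‖ with hh2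
  have c1 : Continuous h1 := continuous_log_norm_one_add a1
  have c2 : Continuous h2 := continuous_log_norm_one_add a2
  set a : ℂ × ℂ := ((Real.exp p.1 : ℂ), (Real.exp p.2 : ℂ)) with ha
  -- With `b_j = a_j e d_j` the boundary circle has logarithmic coordinates `p_j + log |1 + e d_j
  -- e^{iθ}|`, to first order an oscillation about `p` along `d`.
  set b : ℂ × ℂ := ((Real.exp p.1 * (e * d.1 : ℝ) : ℂ), (Real.exp p.2 * (e * d.2 : ℝ) : ℂ)) with hb
  have hnorm : ∀ (x c : ℝ) (ζ : ℂ), ‖ζ‖ ≤ 1 → |c| ≤ D → Real.exp x * (1 + e * D) - 1 < 0 →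
      ‖(Real.exp x : ℂ) + ζ • ((Real.exp x : ℂ) * (e * c : ℝ))‖ < 1 := by
    intro x c ζ hζ hc hx
    have : (Real.exp x : ℂ) + ζ • ((Real.exp x : ℂ) * (e * c : ℝ))
        = (Real.exp x : ℂ) * (1 + ζ * (e * c : ℝ)) := by
      simp only [smul_eq_mul]; ring
    rw [this, norm_mul, Complex.norm_real, Real.norm_of_nonneg (Real.exp_pos x).le]
    have : ‖1 + ζ * ((e * c : ℝ) : ℂ)‖ ≤ 1 + e * D := by
      refine (norm_add_le _ _).trans ?_
      rw [norm_one, norm_mul, Complex.norm_real, Real.norm_eq_abs, abs_mul, abs_of_pos he]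
      have : ‖ζ‖ * (e * |c|) ≤ 1 * (e * D) := by gcongr
      linarith
    nlinarith [Real.exp_pos x]
  have hin : ∀ ζ : ℂ, ‖ζ‖ ≤ 1 → a + ζ • b ∈ unitPolydisk := fun ζ hζ =>
    ⟨hnorm p.1 d.1 ζ hζ hD1 (by linarith), hnorm p.2 d.2 ζ hζ hD2 (by linarith)⟩
  have hsub := hφ.psh.sub_mean a b hin
  have herr : ∀ (c : ℝ) (θ : ℝ), |e * c| ≤ 1 / 2 → |c| ≤ D →
      |Real.log ‖1 + ((e * c : ℝ) : ℂ) * Complex.exp (θ * Complex.I)‖ - e * c * Real.cos θ|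
        ≤ e ^ 2 * D ^ 2 := by
    intro c θ hc hcD
    refine (log_norm_one_add_sub_le hc).trans ?_
    rw [mul_pow]
    have : c ^ 2 ≤ D ^ 2 := sq_le_sq' (by linarith [neg_abs_le c]) (by linarith [le_abs_self c])
    gcongr
  have hlarge : ∀ (c : ℝ) (θ : ℝ), |e * c| ≤ 1 / 2 → |c| ≤ D →
      |Real.log ‖1 + ((e * c : ℝ) : ℂ) * Complex.exp (θ * Complex.I)‖| < ρ := by
    intro c θ hc hcD
    have := herr c θ hc hcD
    have h2 : |e * c * Real.cos θ| ≤ e * D := by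
      rw [abs_mul, abs_mul, abs_of_pos he]
      calc e * |c| * |Real.cos θ| ≤ e * D * 1 := by
            gcongr
            exact Real.abs_cos_le_one θ
        _ = e * D := mul_one _
    rw [abs_le] at this h2
    rw [abs_lt]
    constructor <;> nlinarith [this.1, this.2, h2.1, h2.2]
  set G : ℝ → ℝ := fun θ => F + l1 * h1 θ + l2 * h2 θ
      - κ * (d.1 * h1 θ + d.2 * h2 θ) ^ 2 + k * (d.1 * h2 θ - d.2 * h1 θ) ^ 2 with hG
  have cG : Continuous G := by fun_prop
  have hle : ∀ θ : ℝ, φ (a + Complex.exp (θ * Complex.I) • b) ≤ (G θ : EReal) := by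
    intro θ
    have hz := hin (Complex.exp (θ * Complex.I)) (by rw [Complex.norm_exp_ofReal_mul_I])
    have key : ∀ (x c : ℝ), (Real.exp x : ℂ) + Complex.exp (θ * Complex.I) •
        ((Real.exp x : ℂ) * (e * c : ℝ)) =
        (Real.exp x : ℂ) * (1 + ((e * c : ℝ) : ℂ) * Complex.exp (θ * Complex.I)) := by
      intro x c
      simp only [smul_eq_mul]; ring
    have hne : ∀ (x c : ℝ), |e * c| ≤ 1 / 2 → (Real.exp x : ℂ) + Complex.exp (θ * Complex.I) •
        ((Real.exp x : ℂ) * (e * c : ℝ)) ≠ 0 := by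
      intro x c hc
      rw [key]
      exact mul_ne_zero (by exact_mod_cast (Real.exp_pos x).ne') (norm_pos_iff.1 (norm_one_add_pos hc))
    have hlog : ∀ (x c : ℝ), |e * c| ≤ 1 / 2 → Real.log ‖(Real.exp x : ℂ) +
        Complex.exp (θ * Complex.I) • ((Real.exp x : ℂ) * (e * c : ℝ))‖ =
        x + Real.log ‖1 + ((e * c : ℝ) : ℂ) * Complex.exp (θ * Complex.I)‖ := by
      intro x c hc
      rw [key, norm_mul, Real.log_mul (by simp) (norm_one_add_pos hc).ne', Complex.norm_real,
        Real.norm_of_nonneg (Real.exp_pos x).le, Real.log_exp]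
    rw [hφ.eq_logTransform hz (hne p.1 d.1 a1) (hne p.2 d.2 a2)]
    have e1 : Real.log ‖(a + Complex.exp (θ * Complex.I) • b).1‖ = p.1 + h1 θ := hlog p.1 d.1 a1
    have e2 : Real.log ‖(a + Complex.exp (θ * Complex.I) • b).2‖ = p.2 + h2 θ := hlog p.2 d.2 a2
    rw [e1, e2]
    have := @hball (p.1 + h1 θ, p.2 + h2 θ) (by
      rw [Prod.dist_eq, max_lt_iff, Real.dist_eq, Real.dist_eq]
      simp only [add_sub_cancel_left]
      exact ⟨hlarge d.1 θ a1 hD1, hlarge d.2 θ a2 hD2⟩)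
    simpa only [add_sub_cancel_left] using this
  have hfin := hsub.trans (mul_le_mul_of_nonneg_left (circleIntegralEReal_mono hle)
    (by exact_mod_cast (by positivity : (0:ℝ) ≤ 1 / (2 * Real.pi))))
  rw [circleIntegralEReal_coe cG, ← EReal.coe_mul] at hfin
  have hφa : φ a = (F : EReal) := hF
  rw [hφa, EReal.coe_le_coe_iff] at hfin
  have hpt : ∀ θ, G θ ≤ F + l1 * h1 θ + l2 * h2 θ
      - κ * e ^ 2 * (d.1 ^ 2 + d.2 ^ 2) ^ 2 / 2 * Real.cos θ ^ 2 + (κ + k) * e ^ 4 * D ^ 6 := by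
    intro θ
    have r1 := herr d.1 θ a1 hD1
    have r2 := herr d.2 θ a2 hD2
    change |h1 θ - _| ≤ _ at r1
    change |h2 θ - _| ≤ _ at r2
    set x1 := h1 θ - e * d.1 * Real.cos θ with hx1
    set x2 := h2 θ - e * d.2 * Real.cos θ with hx2
    have i1 : h1 θ = e * d.1 * Real.cos θ + x1 := by rw [hx1]; ring
    have i2 : h2 θ = e * d.2 * Real.cos θ + x2 := by rw [hx2]; ring
    have := concave_paraboloid_le (e := e) (c := Real.cos θ) hκ hk r1 r2
    rw [← i1, ← i2] at this
    simp only [hG]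
    linarith
  have iC : ∀ g : ℝ → ℝ, Continuous g → IntegrableOn g (Icc (0 : ℝ) (2 * Real.pi)) :=
    fun g hg => hg.continuousOn.integrableOn_Icc
  have hint : ∫ θ in Icc (0 : ℝ) (2 * Real.pi), G θ ≤ 2 * Real.pi * F
      - κ * e ^ 2 * (d.1 ^ 2 + d.2 ^ 2) ^ 2 / 2 * Real.pi
        + 2 * Real.pi * ((κ + k) * e ^ 4 * D ^ 6) := by
    refine (setIntegral_mono (iC _ cG) (iC _ (by fun_prop)) hpt).trans (le_of_eq ?_)
    rw [integral_add (iC _ (by fun_prop)) (iC _ (by fun_prop)),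
      integral_sub (iC _ (by fun_prop)) (iC _ (by fun_prop)),
      integral_add (iC _ (by fun_prop)) (iC _ (by fun_prop)),
      integral_add (iC _ (by fun_prop)) (iC _ (by fun_prop)),
      integral_const_mul, integral_const_mul, integral_const_mul, integral_cos_sq_circle,
      integral_log_norm_one_add a1, integral_log_norm_one_add a2]
    simp [Real.pi_pos.le]
  have hpi := Real.pi_pos
  have h3 : F * (2 * Real.pi) ≤ ∫ θ in Icc (0 : ℝ) (2 * Real.pi), G θ := by
    rw [one_div, inv_mul_eq_div, le_div_iff₀ (by positivity)] at hfin
    exact hfin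
  have h4 : 0 < e ^ 2 * (2 * Real.pi) := by positivity
  -- The mean over the circle would be less than `F`: this is the last condition on `e`, multiplied
  -- by `2π e²`.
  nlinarith [mul_neg_of_pos_of_neg h4 e7]

/-- The domain `{t | t₁ < 0, t₂ < 0}` of logarithmic transforms. -/
def negQuadrant : Set (ℝ × ℝ) := Iio 0 ×ˢ Iio 0

theorem isOpen_negQuadrant : IsOpen negQuadrant := isOpen_Iio.prod isOpen_Iio

theorem convex_negQuadrant : Convex ℝ negQuadrant := (convex_Iio 0).prod (convex_Iio 0)

theorem exp_mem_unitPolydisk {t : ℝ × ℝ} (ht : t ∈ negQuadrant) :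
    ((Real.exp t.1 : ℂ), (Real.exp t.2 : ℂ)) ∈ unitPolydisk := by
  have h1 : t.1 < 0 := ht.1
  have h2 : t.2 < 0 := ht.2
  constructor <;> simpa [Complex.norm_real, abs_of_pos (Real.exp_pos _), ← Complex.ofReal_exp]

/-! ### Chord inequality and finiteness of the logarithmic transform -/

namespace IsToricPsh

variable {φ : ℂ × ℂ → EReal}

theorem logTransform_lt_top (hφ : IsToricPsh φ) {t : ℝ × ℝ} (ht : t ∈ negQuadrant) :
    logTransform φ t < ⊤ := hφ.psh.lt_top _ (exp_mem_unitPolydisk ht)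

theorem usc_logTransform (hφ : IsToricPsh φ) :
    UpperSemicontinuousOn (logTransform φ) negQuadrant := by
  have := hφ.psh.usc.comp (t := negQuadrant)
    (g := fun t : ℝ × ℝ => ((Real.exp t.1 : ℂ), (Real.exp t.2 : ℂ)))
    (Continuous.continuousOn (by fun_prop)) (fun t ht => exp_mem_unitPolydisk ht)
  exact this

/-- Suppose the chord bound fails. Thicken the segment to a thin rectangle and subtract from the
function a quadratic `q`, concave along `d` and convex across. An upper semicontinuous function
attains its maximum on the compact rectangle; here it is positive, hence interior, and there a
translate of `q` touches from above, against `not_touched`. -/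
theorem logTransform_le_of_lt (hφ : IsToricPsh φ) {p d : ℝ × ℝ} (hp : p ∈ negQuadrant)
    (hpd : p + d ∈ negQuadrant) {c0 c1 s : ℝ} (hs : 0 < s) (hs1 : s < 1)
    (h0 : logTransform φ p < c0) (h1 : logTransform φ (p + d) < c1) :
    logTransform φ (p + s • d) ≤ ((c0 + s * (c1 - c0) : ℝ) : EReal) := by
  by_contra! hlt
  set f := logTransform φ with hf
  have hd : d ≠ 0 := by
    rintro rfl
    simp only [smul_zero, add_zero] at hlt h1
    have h0' := EReal.coe_lt_coe_iff.1 (hlt.trans h0)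
    have h1' := EReal.coe_lt_coe_iff.1 (hlt.trans h1)
    nlinarith
  have hN : 0 < d.1 ^ 2 + d.2 ^ 2 := by
    rcases not_and_or.1 (fun h : d.1 = 0 ∧ d.2 = 0 => hd (Prod.ext h.1 h.2)) with h | h <;> positivity
  set N := d.1 ^ 2 + d.2 ^ 2 with hNdef
  set n : ℝ × ℝ := (-d.2, d.1) with hn
  have hev : ∀ {x : ℝ × ℝ} {c : ℝ}, x ∈ negQuadrant → f x < c →
      ∀ᶠ τ in 𝓝 (0 : ℝ), x + τ • n ∈ negQuadrant ∧ f (x + τ • n) < c := by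
    intro x c hx hxc
    have ht : Tendsto (fun τ : ℝ => x + τ • n) (𝓝 0) (𝓝 x) := by
      have : Continuous fun τ : ℝ => x + τ • n := by fun_prop
      simpa using this.tendsto 0
    have h1 := hφ.usc_logTransform x hx c hxc
    rw [isOpen_negQuadrant.nhdsWithin_eq hx] at h1
    have h2 : ∀ᶠ y in 𝓝 x, y ∈ negQuadrant := isOpen_negQuadrant.mem_nhds hx
    exact ht.eventually (h2.and h1)
  obtain ⟨η, hη, hball⟩ :=
    Metric.nhds_basis_closedBall.eventually_iff.1 ((hev hp h0).and (hev hpd h1))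
  set E : ℝ × ℝ → ℝ × ℝ := fun x => p + x.1 • d + x.2 • n with hE
  have hEc : Continuous E := by fun_prop
  set K : Set (ℝ × ℝ) := Icc 0 1 ×ˢ Metric.closedBall 0 η with hK
  have hKc : IsCompact K := isCompact_Icc.prod (isCompact_closedBall 0 η)
  have hEK : MapsTo E K negQuadrant := by
    rintro ⟨a, τ⟩ ⟨ha, hτ⟩
    obtain ⟨⟨q1, -⟩, q2, -⟩ := hball hτ
    have := convex_negQuadrant q1 q2 (sub_nonneg.2 ha.2) ha.1 (by simp)
    convert this using 1
    simp only [hE]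
    module
  have husc : UpperSemicontinuousOn (fun x => f (E x)) K :=
    hφ.usc_logTransform.comp hEc.continuousOn hEK
  have hK0 : (s, (0 : ℝ)) ∈ K := ⟨⟨hs.le, hs1.le⟩, by simp [hη.le]⟩
  obtain ⟨m, hm, hmax⟩ := husc.exists_isMaxOn ⟨_, hK0⟩ hKc
  obtain ⟨M, hM, -⟩ := EReal.lt_iff_exists_real_btwn.1 (hφ.logTransform_lt_top (hEK hm))
  have hMK : ∀ x ∈ K, f (E x) < M := fun x hx => (hmax hx).trans_lt hM
  obtain ⟨r, hr, hrf⟩ := EReal.lt_iff_exists_real_btwn.1 hlt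
  rw [EReal.coe_lt_coe_iff] at hr
  -- Chosen so that `q (s, 0) = r`, which lies below the value of the function at the bad point; the
  -- maximum of the difference is thus positive.
  set κ := (r - (c0 + s * (c1 - c0))) / (s * (1 - s)) with hκdef
  have hss : 0 < s * (1 - s) := mul_pos hs (by linarith)
  have hκ : 0 < κ := div_pos (by linarith) hss
  have hκs : κ * (s * (1 - s)) = r - (c0 + s * (c1 - c0)) := div_mul_cancel₀ _ hss.ne'
  -- Chosen so that `q ≥ M` on the sides at distance `η`, which excludes a positive maximum there.
  set k := (|M| + |c0| + |c1|) / η ^ 2 with hkdef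
  have hk : 0 ≤ k := by positivity
  have hkη : k * η ^ 2 = |M| + |c0| + |c1| := div_mul_cancel₀ _ (by positivity)
  set q : ℝ × ℝ → ℝ := fun x => c0 + x.1 * (c1 - c0) + κ * (x.1 * (1 - x.1)) + k * x.2 ^ 2 with hq
  have hqc : Continuous q := by fun_prop
  have huscg : UpperSemicontinuousOn (fun x => f (E x) + ((-q x : ℝ) : EReal)) K := by
    refine husc.add' (g := fun x => ((-q x : ℝ) : EReal)) ?_ ?_
    · exact (continuous_coe_real_ereal.comp hqc.neg).continuousOn.upperSemicontinuousOn
    · intro x hx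
      exact EReal.continuousAt_add (Or.inr (EReal.coe_ne_bot _)) (Or.inr (EReal.coe_ne_top _))
  obtain ⟨x, hx, hxmax⟩ := huscg.exists_isMaxOn ⟨_, hK0⟩ hKc
  have hcases : ∀ y ∈ K, ∀ c : ℝ, (f (E y) + ((-q y : ℝ) : EReal) ≤ (c : EReal) →
      f (E y) ≤ ((c + q y : ℝ) : EReal)) := by
    intro y hy c hc
    have := hMK y hy
    generalize f (E y) = w at *
    induction w with
    | bot => exact bot_le
    | coe w =>
      norm_cast at hc ⊢
      linarith
    | top => simp at this
  obtain ⟨F, hFx, hFq⟩ : ∃ F : ℝ, f (E x) = (F : EReal) ∧ q x < F := by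
    have h1 : ((0 : ℝ) : EReal) < f (E x) + ((-q x : ℝ) : EReal) := by
      by_contra! hcon
      have h2 := hcases _ hK0 0 ((hxmax hK0).trans hcon)
      have h3 : q (s, 0) = r := by
        simp only [hq]
        rw [hκs]
        ring
      rw [h3] at h2
      have h4 : E (s, 0) = p + s • d := by simp [hE]
      rw [h4, zero_add] at h2
      exact absurd hrf h2.not_gt
    have := hMK x hx
    generalize f (E x) = w at *
    induction w with
    | bot => simp at h1
    | coe w =>
      norm_cast at h1
      exact ⟨w, rfl, by linarith⟩
    | top => simp at this
  have hqlow : c0 + x.1 * (c1 - c0) + k * x.2 ^ 2 ≤ q x := by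
    have : 0 ≤ κ * (x.1 * (1 - x.1)) :=
      mul_nonneg hκ.le (mul_nonneg hx.1.1 (sub_nonneg.2 hx.1.2))
    simp only [hq]
    linarith
  have hx2 : |x.2| ≤ η := by simpa using hx.2
  have hxη : |x.2| < η := by
    refine lt_of_le_of_ne hx2 fun h => ?_
    have h1 : F < M := by
      have := hMK x hx
      rw [hFx] at this
      exact_mod_cast this
    have h2 : k * x.2 ^ 2 = |M| + |c0| + |c1| := by rw [← sq_abs, h, hkη]
    have h3 : -|c0| - |c1| ≤ c0 + x.1 * (c1 - c0) := by
      have := hx.1.1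
      have := hx.1.2
      have a0 := neg_abs_le c0
      have a1 := neg_abs_le c1
      nlinarith [abs_nonneg c0, abs_nonneg c1]
    linarith [le_abs_self M]
  have hx0 : 0 < x.1 := by
    refine lt_of_le_of_ne hx.1.1 fun h => ?_
    have h1 := (hball hx.2).1.2
    have h2 : E x = p + x.2 • n := by simp [hE, ← h]
    rw [← h2, hFx, EReal.coe_lt_coe_iff] at h1
    rw [← h] at hqlow
    nlinarith [mul_nonneg hk (sq_nonneg x.2)]
  have hx1 : x.1 < 1 := by
    refine lt_of_le_of_ne hx.1.2 fun h => ?_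
    have h1 := (hball hx.2).2.2
    have h2 : E x = p + d + x.2 • n := by simp [hE, h]
    rw [← h2, hFx, EReal.coe_lt_coe_iff] at h1
    rw [h] at hqlow
    nlinarith [mul_nonneg hk (sq_nonneg x.2)]
  set P := E x with hP
  -- The inverse of `E`: orthogonal coordinates along `d` and its rotation `n`, both of squared
  -- length `N`.
  set R : ℝ × ℝ → ℝ × ℝ := fun t => (x.1 + (d.1 * (t.1 - P.1) + d.2 * (t.2 - P.2)) / N,
    x.2 + (d.1 * (t.2 - P.2) - d.2 * (t.1 - P.1)) / N) with hR
  have hRc : Continuous R := by fun_prop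
  have hER : ∀ t, E (R t) = t := by
    intro t
    have e1 : P.1 = p.1 + x.1 * d.1 + x.2 * (-d.2) := by simp [hP, hE, hn]
    have e2 : P.2 = p.2 + x.1 * d.2 + x.2 * d.1 := by simp [hP, hE, hn]
    ext
    · simp only [hE, hR, hn, Prod.fst_add, Prod.smul_fst, smul_eq_mul]
      field_simp
      rw [e1, hNdef]
      ring
    · simp only [hE, hR, hn, Prod.snd_add, Prod.smul_snd, smul_eq_mul]
      field_simp
      rw [e2, hNdef]
      ring
  have hRP : R P = x := by simp [hR]
  have hnear : ∀ᶠ t in 𝓝 P, R t ∈ K := by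
    have hnhds : K ∈ 𝓝 (R P) := by
      rw [hRP]
      exact prod_mem_nhds (Icc_mem_nhds hx0 hx1)
        (Metric.closedBall_mem_nhds_of_mem (by simpa using hxη))
    exact hRc.continuousAt.eventually hnhds
  have hPQ : P ∈ negQuadrant := hEK hx
  -- The coefficients are those of the expansion of `q ∘ R` at `P`, which is exact because `q` is
  -- quadratic.
  refine hφ.not_touched (p := P) hPQ.1 hPQ.2 hd (κ := κ / N ^ 2) (k := k / N ^ 2)
    (l1 := (c1 - c0 + κ * (1 - 2 * x.1)) * d.1 / N - 2 * k * x.2 * d.2 / N)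
    (l2 := (c1 - c0 + κ * (1 - 2 * x.1)) * d.2 / N + 2 * k * x.2 * d.1 / N)
    (by positivity) (by positivity) hFx ?_
  filter_upwards [hnear] with t ht
  have h1 := hxmax ht
  simp only at h1
  rw [← hP, hFx, ← EReal.coe_add] at h1
  have h2 := hcases _ ht _ h1
  rw [hER] at h2
  refine h2.trans (le_of_eq ?_)
  congr 1
  simp only [hq, hR]
  field_simp
  ring

theorem isOpen_unitPolydisk : IsOpen unitPolydisk :=
  (isOpen_lt continuous_fst.norm continuous_const).inter
    (isOpen_lt continuous_snd.norm continuous_const)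

theorem log_mem_negQuadrant {z : ℂ × ℂ} (hz : z ∈ unitPolydisk) (h1 : z.1 ≠ 0) (h2 : z.2 ≠ 0) :
    (Real.log ‖z.1‖, Real.log ‖z.2‖) ∈ negQuadrant :=
  ⟨Real.log_neg (norm_pos_iff.2 h1) hz.1, Real.log_neg (norm_pos_iff.2 h2) hz.2⟩

/-- By the chord inequality a single value `⊥` spreads over the open quadrant, that is, over the
polydisk off the axes. A disc with boundary off the axes then gives `⊥` at its centre, so `φ` would
be identically `⊥`. -/
theorem logTransform_ne_bot (hφ : IsToricPsh φ) {t : ℝ × ℝ} (ht : t ∈ negQuadrant) :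
    logTransform φ t ≠ ⊥ := by
  intro hbot
  have hall : ∀ u ∈ negQuadrant, logTransform φ u = ⊥ := by
    intro u hu
    have hc : ContinuousAt (fun e : ℝ => u + e • (u - t)) 0 := by fun_prop
    have hev : ∀ᶠ e in 𝓝[>] (0 : ℝ), u + e • (u - t) ∈ negQuadrant := by
      refine (hc.eventually (isOpen_negQuadrant.mem_nhds ?_)).filter_mono nhdsWithin_le_nhds
      simpa using hu
    obtain ⟨e, heQ, he⟩ := (hev.and self_mem_nhdsWithin).exists
    have he : 0 < e := he
    obtain ⟨c1, hc1, -⟩ := EReal.lt_iff_exists_real_btwn.1 (hφ.logTransform_lt_top heQ)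
    -- The point `u` sits at parameter `s` on the segment from `t` to a point slightly beyond `u`.
    -- The bound at `t` may be arbitrarily low, and `c0` below makes the chord equal to `y - 1` at
    -- `u`.
    set s := (1 + e)⁻¹ with hs
    have hs0 : 0 < s := by positivity
    have hs1 : s < 1 := inv_lt_one_of_one_lt₀ (by linarith)
    have hd : t + (u + e • (u - t) - t) = u + e • (u - t) := by module
    have hu' : t + s • (u + e • (u - t) - t) = u := by
      have : u + e • (u - t) - t = (1 + e) • (u - t) := by module
      rw [this, smul_smul, hs, inv_mul_cancel₀ (by positivity)]
      module
    rw [EReal.eq_bot_iff_forall_lt]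
    intro y
    set c0 := (y - 1 - s * c1) / (1 - s)
    have := hφ.logTransform_le_of_lt (d := u + e • (u - t) - t) ht (by rwa [hd]) hs0 hs1
      (c0 := c0) (c1 := c1) (by rw [hbot]; exact EReal.bot_lt_coe _) (by rwa [hd])
    rw [hu'] at this
    refine this.trans_lt (EReal.coe_lt_coe_iff.2 ?_)
    have : c0 * (1 - s) = y - 1 - s * c1 := div_mul_cancel₀ _ (by linarith)
    linarith
  obtain ⟨z, hz, hzb⟩ := hφ.psh.exists_ne_bot
  -- A zero coordinate is moved on a circle of radius `1/2`, a nonzero one is kept fixed, so the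
  -- boundary circle avoids the axes.
  have hcoord : ∀ w : ℂ, ‖w‖ < 1 → ∃ b : ℂ, (∀ ζ : ℂ, ‖ζ‖ ≤ 1 → ‖w + ζ • b‖ < 1) ∧
      ∀ ζ : ℂ, ‖ζ‖ = 1 → w + ζ • b ≠ 0 := by
    intro w hw
    by_cases h0 : w = 0
    · refine ⟨1 / 2, fun ζ hζ => ?_, fun ζ hζ h => ?_⟩
      · simp only [h0, zero_add, norm_smul]
        norm_num
        linarith
      · simp only [h0, zero_add, smul_eq_mul] at h
        have : ζ = 0 := by simpa using h
        simp [this] at hζ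
    · exact ⟨0, fun ζ _ => by simpa using hw, fun ζ _ => by simpa using h0⟩
  obtain ⟨b1, hb1, hb1'⟩ := hcoord z.1 hz.1
  obtain ⟨b2, hb2, hb2'⟩ := hcoord z.2 hz.2
  have hin : ∀ ζ : ℂ, ‖ζ‖ ≤ 1 → z + ζ • (b1, b2) ∈ unitPolydisk :=
    fun ζ hζ => ⟨hb1 ζ hζ, hb2 ζ hζ⟩
  have hsub := hφ.psh.sub_mean z (b1, b2) hin
  have hval : ∀ θ : ℝ, φ (z + Complex.exp (θ * Complex.I) • (b1, b2)) = ⊥ := by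
    intro θ
    have hn := Complex.norm_exp_ofReal_mul_I θ
    have h1 := hb1' _ hn
    have h2 := hb2' _ hn
    rw [hφ.eq_logTransform (hin _ hn.le) h1 h2]
    exact hall _ (log_mem_negQuadrant (hin _ hn.le) h1 h2)
  simp only [hval] at hsub
  have hci : circleIntegralEReal (fun _ => ⊥) = ⊥ := by
    simp [circleIntegralEReal, Real.pi_pos]
  rw [hci, EReal.coe_mul_bot_of_pos (by positivity), le_bot_iff] at hsub
  exact hzb hsub

end IsToricPsh

/-- The logarithmic transform as a real-valued function. -/
def hat (φ : ℂ × ℂ → EReal) (t : ℝ × ℝ) : ℝ := (logTransform φ t).toReal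

/-- A strict decrease somewhere forces slopes at most `-m < 0` further left, hence growth to `+∞` at
`-∞`. -/
theorem ConvexOn.monotoneOn_of_eventually_le {g : ℝ → ℝ} {a C : ℝ} (hg : ConvexOn ℝ (Iio a) g)
    (hC : ∀ᶠ x in atBot, g x ≤ C) : MonotoneOn g (Iio a) := by
  intro x hx y hy hxy
  rcases hxy.eq_or_lt with rfl | hxy
  · exact le_rfl
  by_contra! hlt
  set m := (g x - g y) / (y - x) with hm
  have hm0 : 0 < m := div_pos (by linarith) (by linarith)
  have hlim : Tendsto (fun u : ℝ => g x + (x - u) * m) atBot atTop := by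
    refine tendsto_atTop_add_const_left _ _ (Tendsto.atTop_mul_const hm0 ?_)
    exact tendsto_atTop_add_const_left _ _ tendsto_neg_atBot_atTop
  obtain ⟨u, hu1, hu2, hu3⟩ := (hC.and ((hlim.eventually_gt_atTop C).and
    (eventually_lt_atBot x))).exists
  have := hg.slope_mono_adjacent (lt_trans hu3 hx : u < a) hy hu3 hxy
  have h2 : (g y - g x) / (y - x) = -m := by rw [hm]; ring
  rw [h2, div_le_iff₀ (by linarith)] at this
  linarith

/-! ### Convexity and monotonicity of `hat φ` -/

namespace IsToricPsh

variable {φ : ℂ × ℂ → EReal}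

theorem coe_hat (hφ : IsToricPsh φ) {t : ℝ × ℝ} (ht : t ∈ negQuadrant) :
    ((hat φ t : ℝ) : EReal) = logTransform φ t :=
  EReal.coe_toReal (hφ.logTransform_lt_top ht).ne (hφ.logTransform_ne_bot ht)

theorem convexOn_hat (hφ : IsToricPsh φ) : ConvexOn ℝ negQuadrant (hat φ) := by
  rw [convexOn_iff_forall_pos]
  refine ⟨convex_negQuadrant, fun x hx y hy a b ha hb hab => ?_⟩
  have hp : a • x + b • y = x + b • (y - x) := by
    rw [← eq_sub_iff_add_eq] at hab
    rw [hab]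
    module
  rw [hp]
  have hxy : x + (y - x) = y := by module
  have hmem : x + b • (y - x) ∈ negQuadrant := hp ▸ convex_negQuadrant hx hy ha.le hb.le hab
  refine le_of_forall_pos_le_add fun ε hε => ?_
  have := hφ.logTransform_le_of_lt (d := y - x) hx (by rwa [hxy]) hb (by linarith)
    (c0 := hat φ x + ε) (c1 := hat φ y + ε)
    (by rw [← hφ.coe_hat hx]; exact_mod_cast lt_add_of_pos_right _ hε)
    (by rw [hxy, ← hφ.coe_hat hy]; exact_mod_cast lt_add_of_pos_right _ hε)
  rw [← hφ.coe_hat hmem, EReal.coe_le_coe_iff] at this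
  refine this.trans (le_of_eq ?_)
  simp only [smul_eq_mul]
  rw [← eq_sub_iff_add_eq] at hab
  rw [hab]
  ring

/-- Meant for points `w` on the axes: upper semicontinuity there bounds `hat φ` as one variable
tends to `-∞`, and convexity turns this bound into monotonicity. -/
theorem exists_eventually_hat_le (hφ : IsToricPsh φ) {γ : ℝ → ℝ × ℝ} {w : ℂ × ℂ}
    (hw : w ∈ unitPolydisk) (hγ : ∀ᶠ x in atBot, γ x ∈ negQuadrant)
    (hlim : Tendsto (fun x => ((Real.exp (γ x).1 : ℂ), (Real.exp (γ x).2 : ℂ))) atBot (𝓝 w)) :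
    ∃ C, ∀ᶠ x in atBot, hat φ (γ x) ≤ C := by
  obtain ⟨C, hC, -⟩ := EReal.lt_iff_exists_real_btwn.1 (hφ.psh.lt_top w hw)
  refine ⟨C, ?_⟩
  have h1 := hφ.psh.usc w hw C hC
  rw [isOpen_unitPolydisk.nhdsWithin_eq hw] at h1
  filter_upwards [hγ, hlim.eventually h1] with x hx h
  change logTransform φ (γ x) < C at h
  rw [← hφ.coe_hat hx] at h
  exact_mod_cast h.le

theorem monotoneOn_hat (hφ : IsToricPsh φ) : MonotoneOn (hat φ) negQuadrant := by
  have hexp : Tendsto (fun x : ℝ => (Real.exp x : ℂ)) atBot (𝓝 0) :=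
    (Complex.continuous_ofReal.tendsto' 0 0 (by simp)).comp Real.tendsto_exp_atBot
  have hnorm : ∀ y < (0 : ℝ), ‖(Real.exp y : ℂ)‖ < 1 := fun y hy => by
    rw [Complex.norm_real, Real.norm_of_nonneg (Real.exp_pos y).le]
    simpa using hy
  have m1 : ∀ y < (0 : ℝ), MonotoneOn (fun x => hat φ (x, y)) (Iio 0) := by
    intro y hy
    obtain ⟨C, hC⟩ := hφ.exists_eventually_hat_le (γ := fun x => (x, y)) (w := (0, (Real.exp y : ℂ)))
      ⟨by simp, hnorm y hy⟩ ((eventually_lt_atBot 0).mono fun x hx => ⟨hx, hy⟩)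
      (hexp.prodMk_nhds tendsto_const_nhds)
    refine ConvexOn.monotoneOn_of_eventually_le ⟨convex_Iio 0, fun a ha b hb s t hs ht hst => ?_⟩ hC
    have := hφ.convexOn_hat.2 (x := (a, y)) ⟨ha, hy⟩ (y := (b, y)) ⟨hb, hy⟩ hs ht hst
    simpa [← add_mul, hst] using this
  have m2 : ∀ x < (0 : ℝ), MonotoneOn (fun y => hat φ (x, y)) (Iio 0) := by
    intro x hx
    obtain ⟨C, hC⟩ := hφ.exists_eventually_hat_le (γ := fun y => (x, y)) (w := ((Real.exp x : ℂ), 0))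
      ⟨hnorm x hx, by simp⟩ ((eventually_lt_atBot 0).mono fun y hy => ⟨hx, hy⟩)
      (tendsto_const_nhds.prodMk_nhds hexp)
    refine ConvexOn.monotoneOn_of_eventually_le ⟨convex_Iio 0, fun a ha b hb s t hs ht hst => ?_⟩ hC
    have := hφ.convexOn_hat.2 (x := (x, a)) ⟨hx, ha⟩ (y := (x, b)) ⟨hx, hb⟩ hs ht hst
    simpa [← add_mul, hst] using this
  rintro ⟨a1, a2⟩ ha ⟨b1, b2⟩ hb hab
  exact (m1 a2 ha.2 ha.1 hb.1 hab.1).trans (m2 b1 hb.1 ha.2 hb.2 hab.2)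

end IsToricPsh

/-! ### Multiplier ideals of toric plurisubharmonic functions: monomials -/

/-- Points of the unit polydisk off the coordinate axes. -/
def puncturedPolydisk : Set (ℂ × ℂ) := {z | z ∈ unitPolydisk ∧ z.1 ≠ 0 ∧ z.2 ≠ 0}

theorem isOpen_puncturedPolydisk : IsOpen puncturedPolydisk :=
  IsToricPsh.isOpen_unitPolydisk.inter ((isOpen_ne_fun continuous_fst continuous_const).inter
    (isOpen_ne_fun continuous_snd continuous_const))

theorem ae_off_axes : ∀ᵐ z : ℂ × ℂ, z.1 ≠ 0 ∧ z.2 ≠ 0 := by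
  have h1 : ∀ᵐ x : ℂ, x ≠ 0 := by
    rw [ae_iff]
    simp
  have e1 : ∀ᵐ z : ℂ × ℂ, z.1 ≠ 0 := Measure.quasiMeasurePreserving_fst.ae h1
  have e2 : ∀ᵐ z : ℂ × ℂ, z.2 ≠ 0 := Measure.quasiMeasurePreserving_snd.ae h1
  exact e1.and e2

/-- The weight `e^{-2cφ}` off the axes, in terms of `hat φ`. -/
def toricWeight (φ : ℂ × ℂ → EReal) (c : ℝ) (z : ℂ × ℂ) : ℝ :=
  Real.exp (-(2 * (c * hat φ (Real.log ‖z.1‖, Real.log ‖z.2‖))))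

/-- The monomial `z₁^a z₂^b`. -/
def monom (a b : ℕ) (z : ℂ × ℂ) : ℂ := z.1 ^ a * z.2 ^ b

theorem analyticAt_monom (a b : ℕ) (x : ℂ × ℂ) : AnalyticAt ℂ (monom a b) x :=
  (analyticAt_fst.pow a).mul (analyticAt_snd.pow b)

theorem zero_mem_unitPolydisk : (0 : ℂ × ℂ) ∈ unitPolydisk := by simp [unitPolydisk]

theorem unitPolydisk_mem_nhds : unitPolydisk ∈ 𝓝 (0 : ℂ × ℂ) :=
  IsToricPsh.isOpen_unitPolydisk.mem_nhds zero_mem_unitPolydisk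

namespace IsToricPsh

variable {φ : ℂ × ℂ → EReal}

theorem multDensity_eq (hφ : IsToricPsh φ) (c : ℝ) (u : ℂ × ℂ → ℂ) {z : ℂ × ℂ}
    (hz : z ∈ puncturedPolydisk) :
    multDensity (fun z => (c : EReal) * φ z) u z = ‖u z‖ₑ ^ 2 * ENNReal.ofReal (toricWeight φ c z) := by
  rw [multDensity, hφ.eq_logTransform hz.1 hz.2.1 hz.2.2,
    ← hφ.coe_hat (log_mem_negQuadrant hz.1 hz.2.1 hz.2.2), toricWeight]
  have : -(2 * ((c : EReal) * ((hat φ (Real.log ‖z.1‖, Real.log ‖z.2‖) : ℝ) : EReal))) =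
      ((-(2 * (c * hat φ (Real.log ‖z.1‖, Real.log ‖z.2‖))) : ℝ) : EReal) := by
    push_cast; rfl
  rw [this, EReal.exp_coe]

theorem continuousOn_toricWeight (hφ : IsToricPsh φ) (c : ℝ) :
    ContinuousOn (toricWeight φ c) puncturedPolydisk := by
  have h1 : ContinuousOn (hat φ) negQuadrant := hφ.convexOn_hat.continuousOn isOpen_negQuadrant
  have h2 : ContinuousOn (fun z : ℂ × ℂ => (Real.log ‖z.1‖, Real.log ‖z.2‖)) puncturedPolydisk := by
    refine ContinuousOn.prodMk ?_ ?_
    · exact ContinuousOn.log (by fun_prop) fun z hz => (norm_pos_iff.2 hz.2.1).ne'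
    · exact ContinuousOn.log (by fun_prop) fun z hz => (norm_pos_iff.2 hz.2.2).ne'
  have h3 := h1.comp h2 fun z hz => log_mem_negQuadrant hz.1 hz.2.1 hz.2.2
  unfold toricWeight
  exact ((h3.const_mul c).const_mul 2).neg.rexp

/-- The axes are null, and off them the weight is continuous because a convex function is continuous
on an open set. -/
theorem aemeasurable_multDensity (hφ : IsToricPsh φ) (c : ℝ) {u : ℂ × ℂ → ℂ} {V : Set (ℂ × ℂ)}
    (hV : IsOpen V) (hVD : V ⊆ unitPolydisk) (hu : ContinuousOn u V) :
    AEMeasurable (multDensity (fun z => (c : EReal) * φ z) u) (volume.restrict V) := by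
  have hm : MeasurableSet (V ∩ puncturedPolydisk) :=
    (hV.inter isOpen_puncturedPolydisk).measurableSet
  have hae : (V ∩ puncturedPolydisk : Set (ℂ × ℂ)) =ᵐ[volume] V := by
    filter_upwards [ae_off_axes] with z hz
    exact propext ⟨fun h => h.1, fun h => ⟨h, hVD h, hz⟩⟩
  rw [← Measure.restrict_congr_set hae]
  have h1 : AEMeasurable u (volume.restrict (V ∩ puncturedPolydisk)) :=
    (hu.mono inter_subset_left).aemeasurable hm
  have h2 : AEMeasurable (toricWeight φ c) (volume.restrict (V ∩ puncturedPolydisk)) :=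
    ((hφ.continuousOn_toricWeight c).mono inter_subset_right).aemeasurable hm
  refine ((h1.enorm.pow_const 2).mul h2.ennreal_ofReal).congr ?_
  filter_upwards [ae_restrict_mem hm] with z hz
  exact (hφ.multDensity_eq c u hz.2).symm

/-- A germ dominated by finitely many members of the multiplier ideal is in it. -/
theorem isMultIntegrable_of_dominated (hφ : IsToricPsh φ) {c : ℝ} {ι : Type*} (s : Finset ι)
    {v : ι → ℂ × ℂ → ℂ} {u : ℂ × ℂ → ℂ} {C : ℝ} (hu : AnalyticAt ℂ u 0)
    (hv : ∀ i ∈ s, IsMultIntegrable (fun z => (c : EReal) * φ z) 0 (v i))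
    (hle : ∀ᶠ z in 𝓝 0, ∃ i ∈ s, ‖u z‖ ≤ C * ‖v i z‖) :
    IsMultIntegrable (fun z => (c : EReal) * φ z) 0 u := by
  choose! U hU hUm hUi using hv
  have hall : ∀ᶠ z in 𝓝 (0 : ℂ × ℂ), ∀ i ∈ s, z ∈ U i :=
    (Finset.eventually_all s).2 fun i hi => hU i hi
  have hD : ∀ᶠ z in 𝓝 (0 : ℂ × ℂ), z ∈ unitPolydisk := unitPolydisk_mem_nhds
  obtain ⟨V, hV, hVo, h0⟩ := mem_nhds_iff.1 (hall.and (hD.and (hle.and hu.eventually_analyticAt)))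
  refine ⟨V, hVo.mem_nhds h0, hφ.aemeasurable_multDensity c hVo (fun z hz => (hV hz).2.1)
    fun z hz => (hV hz).2.2.2.continuousAt.continuousWithinAt, ?_⟩
  have hr : ∀ i ∈ s, volume.restrict V ≤ volume.restrict (U i) := fun i hi =>
    Measure.restrict_mono (fun z hz => (hV hz).1 i hi) le_rfl
  calc ∫⁻ z in V, multDensity (fun z => (c : EReal) * φ z) u z
      ≤ ∫⁻ z in V, ENNReal.ofReal C ^ 2 *
          ∑ i ∈ s, multDensity (fun z => (c : EReal) * φ z) (v i) z := by
        refine setLIntegral_mono' hVo.measurableSet fun z hz => ?_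
        obtain ⟨i, hi, hz⟩ := (hV hz).2.2.1
        refine le_trans ?_ (mul_le_mul_right (Finset.single_le_sum
          (f := fun i => multDensity (fun z => (c : EReal) * φ z) (v i) z)
          (fun _ _ => zero_le) hi) _)
        simp only [multDensity]
        rw [← mul_assoc (ENNReal.ofReal C ^ 2), ← mul_pow]
        gcongr
        rw [← ofReal_norm, ← ofReal_norm, ← ENNReal.ofReal_mul' (norm_nonneg _)]
        exact ENNReal.ofReal_le_ofReal hz
    _ = ENNReal.ofReal C ^ 2 *
          ∑ i ∈ s, ∫⁻ z in V, multDensity (fun z => (c : EReal) * φ z) (v i) z := by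
        rw [lintegral_const_mul' _ _ (by simp), lintegral_finsetSum' _ fun i hi =>
          (hUm i hi).mono_measure (hr i hi)]
    _ < ⊤ := by
        refine ENNReal.mul_lt_top (by simp) (ENNReal.sum_lt_top.2 fun i hi => ?_)
        exact (lintegral_mono' (hr i hi) le_rfl).trans_lt (hUi i hi)

end IsToricPsh

/-! ### Monomials and the Newton body: the integrability criterion -/

theorem lintegral_ball_norm_rpow_lt_top {s : ℝ} (hs : -2 < s) :
    ∫⁻ z in Metric.ball (0 : ℂ) 1, ENNReal.ofReal (‖z‖ ^ s) < ⊤ := by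
  have h1 : IntegrableOn (fun y : ℝ => y ^ (s + 1)) (Ioo 0 1) := by
    rw [intervalIntegral.integrableOn_Ioo_rpow_iff one_pos]
    linarith
  have h2 : Integrable (fun z : ℂ => (Iio (1 : ℝ)).indicator (fun y => y ^ s) ‖z‖) := by
    rw [integrable_fun_norm_addHaar]
    have h3 : IntegrableOn ((Ioo (0 : ℝ) 1).indicator fun y => y ^ (s + 1)) (Ioi 0) :=
      (h1.integrable_indicator measurableSet_Ioo).integrableOn
    refine h3.congr_fun (fun y hy => ?_) measurableSet_Ioi
    have hy : 0 < y := hy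
    by_cases h : y < 1
    · simp [indicator, h, hy, Real.rpow_add_one hy.ne', mul_comm]
    · simp [indicator, h]
  have h4 := h2.2
  rw [HasFiniteIntegral] at h4
  refine lt_of_le_of_lt ?_ h4
  rw [← lintegral_indicator Metric.isOpen_ball.measurableSet]
  refine lintegral_mono fun z => ?_
  by_cases h : ‖z‖ < 1
  · simp only [indicator, Metric.mem_ball, dist_zero_right, h, if_true, mem_Iio]
    exact Real.ofReal_le_enorm _
  · simp [indicator, h]

/-- The exponents `lam` such that `⟨lam, t⟩ ≤ φ̂ (t) + O(1)`. -/
def linearMinorants (φ : ℂ × ℂ → EReal) : Set (ℝ × ℝ) :=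
  {lam : ℝ × ℝ | 0 ≤ lam.1 ∧ 0 ≤ lam.2 ∧ ∃ C : ℝ, ∀ t : ℝ × ℝ, t.1 < 0 → t.2 < 0 →
    ((lam.1 * t.1 + lam.2 * t.2 : ℝ) : EReal) ≤ logTransform φ t + (C : EReal)}

/-- The points that stay in `A` after a small diagonal move towards the origin. -/
def diagInterior (A : Set (ℝ × ℝ)) : Set (ℝ × ℝ) :=
  {lam | ∃ ε : ℝ, 0 < ε ∧ (lam.1 - ε, lam.2 - ε) ∈ A}

namespace IsToricPsh

variable {φ : ℂ × ℂ → EReal}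

theorem mem_linearMinorants (hφ : IsToricPsh φ) {lam : ℝ × ℝ} :
    lam ∈ linearMinorants φ ↔ 0 ≤ lam.1 ∧ 0 ≤ lam.2 ∧ ∃ C : ℝ, ∀ t ∈ negQuadrant,
      lam.1 * t.1 + lam.2 * t.2 ≤ hat φ t + C := by
  refine and_congr_right fun _ => and_congr_right fun _ => exists_congr fun C => ?_
  refine forall_congr' fun t => ⟨fun h ht => ?_, fun h h1 h2 => ?_⟩
  · have := h ht.1 ht.2
    rw [← hφ.coe_hat ht] at this
    exact_mod_cast this
  · rw [← hφ.coe_hat ⟨h1, h2⟩]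
    exact_mod_cast h ⟨h1, h2⟩

/-- The minorant with exponents `(a+1)/c - ε` and `(b+1)/c - ε` bounds the density by a constant
times `|z₁|^s |z₂|^s` with `s = -2 + 2cε > -2`, integrable in each variable. -/
theorem isMultIntegrable_monom (hφ : IsToricPsh φ) {c : ℝ} (hc : 0 < c) {a b : ℕ}
    (h : ((a + 1) / c, (b + 1) / c) ∈ diagInterior (linearMinorants φ)) :
    IsMultIntegrable (fun z => (c : EReal) * φ z) 0 (monom a b) := by
  obtain ⟨ε, hε, hmem⟩ := h
  obtain ⟨-, -, C, hC⟩ := hφ.mem_linearMinorants.1 hmem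
  refine ⟨unitPolydisk, unitPolydisk_mem_nhds, hφ.aemeasurable_multDensity c isOpen_unitPolydisk
    subset_rfl fun z _ => (analyticAt_monom a b z).continuousAt.continuousWithinAt, ?_⟩
  set s := -2 + 2 * c * ε with hs
  have hint := lintegral_ball_norm_rpow_lt_top (s := s) (by rw [hs]; nlinarith)
  have hprod : unitPolydisk = Metric.ball (0 : ℂ) 1 ×ˢ Metric.ball (0 : ℂ) 1 := by
    ext z
    simp [unitPolydisk]
  have hmeas : AEMeasurable (fun z : ℂ => ENNReal.ofReal (‖z‖ ^ s))
      (volume.restrict (Metric.ball 0 1)) := by fun_prop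
  calc ∫⁻ z in unitPolydisk, multDensity (fun z => (c : EReal) * φ z) (monom a b) z
      ≤ ∫⁻ z in unitPolydisk, ENNReal.ofReal (Real.exp (2 * c * C)) *
          (ENNReal.ofReal (‖z.1‖ ^ s) * ENNReal.ofReal (‖z.2‖ ^ s)) := by
        refine lintegral_mono_ae ?_
        filter_upwards [ae_restrict_mem isOpen_unitPolydisk.measurableSet,
          ae_restrict_of_ae ae_off_axes] with z hz hz0
        rw [hφ.multDensity_eq c _ ⟨hz, hz0⟩, ← ENNReal.ofReal_mul (by positivity),
          ← ENNReal.ofReal_mul (by positivity), ← ofReal_norm, ← ENNReal.ofReal_pow (by positivity),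
          ← ENNReal.ofReal_mul (by positivity)]
        refine ENNReal.ofReal_le_ofReal ?_
        have p1 : 0 < ‖z.1‖ := norm_pos_iff.2 hz0.1
        have p2 : 0 < ‖z.2‖ := norm_pos_iff.2 hz0.2
        have hCz := hC _ (log_mem_negQuadrant hz hz0.1 hz0.2)
        simp only at hCz
        have hpow : ∀ {x : ℝ} (n : ℕ), 0 < x → x ^ n = Real.exp (Real.log x * n) := fun n hx => by
          rw [← Real.rpow_natCast, Real.rpow_def_of_pos hx]
        rw [monom, norm_mul, norm_pow, norm_pow, hpow a p1, hpow b p2, Real.rpow_def_of_pos p1,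
          Real.rpow_def_of_pos p2, toricWeight, ← Real.exp_add, ← Real.exp_nat_mul, ← Real.exp_add,
          ← Real.exp_add, ← Real.exp_add, Real.exp_le_exp]
        have := mul_le_mul_of_nonneg_left hCz (by positivity : 0 ≤ 2 * c)
        have e1 : c * ((a + 1) / c) = a + 1 := by field_simp
        have e2 : c * ((b + 1) / c) = b + 1 := by field_simp
        set x := Real.log ‖z.1‖
        set y := Real.log ‖z.2‖
        have e3 : 2 * c * (((a + 1) / c - ε) * x + ((b + 1) / c - ε) * y) =
            2 * ((a + 1) - c * ε) * x + 2 * ((b + 1) - c * ε) * y := by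
          field_simp
        rw [e3] at this
        push_cast
        rw [hs]
        linarith
    _ = ENNReal.ofReal (Real.exp (2 * c * C)) *
          ((∫⁻ z in Metric.ball (0 : ℂ) 1, ENNReal.ofReal (‖z‖ ^ s)) *
            ∫⁻ z in Metric.ball (0 : ℂ) 1, ENNReal.ofReal (‖z‖ ^ s)) := by
        rw [lintegral_const_mul' _ _ (by simp), hprod, Measure.volume_eq_prod,
          ← Measure.prod_restrict, lintegral_prod_mul hmeas hmeas]
    _ < ⊤ := ENNReal.mul_lt_top (by simp) (ENNReal.mul_lt_top hint hint)

/-- Linear growth from a base point: a convex function that exceeds its value at the corner by `1`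
far away grows at least linearly. -/
theorem mem_diagInterior_of_growth (hφ : IsToricPsh φ) {c p q T N : ℝ} (hc : 0 < c) (hp : 1 ≤ p)
    (hq : 1 ≤ q) (hT : T < 0)
    (h : ∀ x y : ℝ, x ≤ T → y ≤ T → x + y ≤ -N →
      c * hat φ (T, T) - p * T - q * T + 1 ≤ c * hat φ (x, y) - p * x - q * y) :
    (p / c, q / c) ∈ diagInterior (linearMinorants φ) := by
  -- A point at `ℓ¹`-distance `M` from the corner `(T, T)` satisfies `x + y ≤ -N`, so the growth
  -- hypothesis applies to it.
  set M := max (2 * T + N) 1 with hM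
  have hM1 : 1 ≤ M := le_max_right _ _
  have hMN : 2 * T + N ≤ M := le_max_left _ _
  have hM0 : 0 < M := by linarith
  set g : ℝ × ℝ → ℝ := fun t => c * hat φ t - p * t.1 - q * t.2 with hg
  set g0 := g (T, T) with hg0
  set m := c * hat φ (T - M, T - M) with hm
  have hTQ : (T, T) ∈ negQuadrant := ⟨hT, hT⟩
  have hTM : (T - M, T - M) ∈ negQuadrant := ⟨by simp; linarith, by simp; linarith⟩
  -- Within distance `M` monotonicity bounds `g` below. Farther out, convexity along the ray from
  -- the corner propagates the gain of `1` at distance `M` to slope `1 / M`.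
  have key : ∀ x y : ℝ, x ≤ T → y ≤ T →
      (2 * T - x - y) / M - (|g0| + 1 + |m|) ≤ g (x, y) := by
    intro x y hx hy
    have hxy : (x, y) ∈ negQuadrant := ⟨lt_of_le_of_lt hx hT, lt_of_le_of_lt hy hT⟩
    set S := 2 * T - x - y with hS
    rcases lt_or_ge S M with hSM | hSM
    · have h1 : hat φ (T - M, T - M) ≤ hat φ (x, y) :=
        hφ.monotoneOn_hat hTM hxy ⟨by simp; linarith, by simp; linarith⟩
      have h2 : m ≤ g (x, y) := by
        have := mul_le_mul_of_nonneg_left h1 hc.le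
        simp only [hg, hm]
        nlinarith
      have h3 : S / M ≤ 1 := (div_le_one hM0).2 hSM.le
      linarith [neg_abs_le m, abs_nonneg g0]
    · have hS0 : 0 < S := by linarith
      set s := M / S with hs
      have hs0 : 0 < s := by positivity
      have hs1 : s ≤ 1 := (div_le_one hS0).2 hSM
      have hsS : s * S = M := div_mul_cancel₀ _ hS0.ne'
      have h1 := h (T + s * (x - T)) (T + s * (y - T)) (by nlinarith) (by nlinarith) (by
        have : s * (x - T) + s * (y - T) = - (s * S) := by rw [hS]; ring
        rw [hsS] at this
        linarith)
      have h2 := hφ.convexOn_hat.2 hTQ hxy (sub_nonneg.2 hs1) hs0.le (by ring)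
      have h3 : (1 - s) • (T, T) + s • (x, y) = (T + s * (x - T), T + s * (y - T)) := by
        ext <;> simp <;> ring
      rw [h3, smul_eq_mul, smul_eq_mul] at h2
      have h4 := mul_le_mul_of_nonneg_left h2 hc.le
      have h5 : 1 ≤ s * (g (x, y) - g0) := by
        simp only [hg0, hg]
        nlinarith
      have h6 : S / M ≤ g (x, y) - g0 := by
        rw [div_le_iff₀ hM0, ← hsS]
        nlinarith
      linarith [neg_abs_le g0, abs_nonneg m]
  -- The slope `1 / M` of `g` is the diagonal room left, after division by `c`.
  refine ⟨1 / (c * M), by positivity, hφ.mem_linearMinorants.2 ?_⟩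
  have hle : ∀ x : ℝ, 1 ≤ x → 0 ≤ x / c - 1 / (c * M) := fun x hx => by
    rw [sub_nonneg, div_le_div_iff₀ (by positivity) hc]
    nlinarith [mul_le_mul hx hM1 zero_le_one (by linarith)]
  have hp' := hle p hp
  have hq' := hle q hq
  refine ⟨hp', hq', (|g0| + 1 + |m| - 2 * T / M) / c
    - T * ((p / c - 1 / (c * M)) + (q / c - 1 / (c * M))), ?_⟩
  rintro ⟨x, y⟩ hxy
  have hx0 : x < 0 := hxy.1
  have hy0 : y < 0 := hxy.2
  -- Points outside the corner region are pushed into it; this lowers `hat φ` and moves each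
  -- coordinate by at most `|T|`, a bounded loss.
  have hminQ : (min x T, min y T) ∈ negQuadrant :=
    ⟨(min_le_right _ _).trans_lt hT, (min_le_right _ _).trans_lt hT⟩
  have h1 := hφ.monotoneOn_hat hminQ hxy ⟨min_le_left _ _, min_le_left _ _⟩
  have h2 := key (min x T) (min y T) (min_le_right _ _) (min_le_right _ _)
  have hx : x + T ≤ min x T := le_min (by linarith) (by linarith)
  have hy : y + T ≤ min y T := le_min (by linarith) (by linarith)
  set x' := min x T
  set y' := min y T
  have h3 : (p / c - 1 / (c * M)) * x' + (q / c - 1 / (c * M)) * y' ≤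
      hat φ (x', y') + (|g0| + 1 + |m| - 2 * T / M) / c := by
    simp only [hg] at h2
    rw [← mul_le_mul_iff_of_pos_left hc]
    have e1 : c * ((p / c - 1 / (c * M)) * x' + (q / c - 1 / (c * M)) * y') =
      p * x' + q * y' - (x' + y') / M := by field_simp; ring
    have e2 : c * (hat φ (x', y') + (|g0| + 1 + |m| - 2 * T / M) / c) =
      c * hat φ (x', y') + (|g0| + 1 + |m| - 2 * T / M) := by field_simp
    have e3 : (2 * T - x' - y') / M = 2 * T / M - (x' + y') / M := by ring
    rw [e1, e2]
    linarith
  have h4 := mul_le_mul_of_nonneg_left hx hp'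
  have h5 := mul_le_mul_of_nonneg_left hy hq'
  simp only
  linarith

end IsToricPsh

/-- The annulus `e^{x-1} < |z| < e^x`. -/
def expAnnulus (x : ℝ) : Set ℂ :=
  Metric.ball 0 (Real.exp x) \ Metric.closedBall 0 (Real.exp (x - 1))

theorem measurableSet_expAnnulus (x : ℝ) : MeasurableSet (expAnnulus x) :=
  Metric.isOpen_ball.measurableSet.diff Metric.isClosed_closedBall.measurableSet

theorem volume_expAnnulus (x : ℝ) : volume (expAnnulus x) =
    ENNReal.ofReal (Real.pi * (1 - Real.exp (-2)) * Real.exp (2 * x)) := by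
  have hsub : Metric.closedBall (0 : ℂ) (Real.exp (x - 1)) ⊆ Metric.ball 0 (Real.exp x) :=
    Metric.closedBall_subset_ball (Real.exp_lt_exp.2 (by linarith))
  have hpi : (NNReal.pi : ENNReal) = ENNReal.ofReal Real.pi := by
    rw [← NNReal.coe_real_pi, ENNReal.ofReal_coe_nnreal]
  rw [expAnnulus, measure_sdiff hsub Metric.isClosed_closedBall.measurableSet.nullMeasurableSet
    (measure_closedBall_lt_top.ne), Complex.volume_ball, Complex.volume_closedBall, hpi,
    ← ENNReal.ofReal_pow (by positivity), ← ENNReal.ofReal_pow (by positivity),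
    ← ENNReal.ofReal_mul (by positivity), ← ENNReal.ofReal_mul (by positivity),
    ← ENNReal.ofReal_sub _ (by positivity), ← Real.exp_nat_mul, ← Real.exp_nat_mul]
  congr 1
  have : Real.exp ((2 : ℕ) * (x - 1)) = Real.exp (-2) * Real.exp (2 * x) := by
    rw [← Real.exp_add]
    congr 1
    push_cast
    ring
  rw [this]
  push_cast
  ring

theorem mem_expAnnulus {x : ℝ} {z : ℂ} (hz : z ∈ expAnnulus x) :
    z ≠ 0 ∧ x - 1 < Real.log ‖z‖ ∧ Real.log ‖z‖ < x := by
  have h1 : ‖z‖ < Real.exp x := by simpa using hz.1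
  have h2 : Real.exp (x - 1) < ‖z‖ := by simpa using hz.2
  have h0 : 0 < ‖z‖ := (Real.exp_pos _).trans h2
  exact ⟨norm_pos_iff.1 h0, (Real.lt_log_iff_exp_lt h0).2 h2, (Real.log_lt_iff_lt_exp h0).2 h1⟩

namespace IsToricPsh

variable {φ : ℂ × ℂ → EReal}

/-- On these annuli monotonicity gives `hat φ ≤ hat φ (x, y)`, and the monomial loses at most a
constant factor. The area factors `e^{2x}` and `e^{2y}` account for the shift from `a, b` to `a + 1,
b + 1`. -/
theorem le_lintegral_expAnnulus (hφ : IsToricPsh φ) {c : ℝ} (hc : 0 < c) (a b : ℕ) {x y : ℝ}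
    (hx : x < 0) (hy : y < 0) :
    ENNReal.ofReal (Real.exp (-(2 * a + 2 * b)) * (Real.pi * (1 - Real.exp (-2))) ^ 2 *
      Real.exp (-(2 * (c * hat φ (x, y) - (a + 1) * x - (b + 1) * y)))) ≤
    ∫⁻ z in expAnnulus x ×ˢ expAnnulus y,
      multDensity (fun z => (c : EReal) * φ z) (monom a b) z := by
  have he : 0 < 1 - Real.exp (-2) := by
    rw [sub_pos, Real.exp_lt_one_iff]
    norm_num
  set L := Real.exp (2 * a * (x - 1) + 2 * b * (y - 1) - 2 * (c * hat φ (x, y))) with hL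
  calc _ = ENNReal.ofReal L * volume (expAnnulus x ×ˢ expAnnulus y) := by
        rw [Measure.volume_eq_prod, Measure.prod_prod, volume_expAnnulus, volume_expAnnulus,
          ← ENNReal.ofReal_mul (by positivity), ← ENNReal.ofReal_mul (by positivity)]
        congr 1
        have : Real.exp (-(2 * a + 2 * b)) *
            Real.exp (-(2 * (c * hat φ (x, y) - (a + 1) * x - (b + 1) * y))) =
            L * Real.exp (2 * x) * Real.exp (2 * y) := by
          rw [hL, ← Real.exp_add, ← Real.exp_add, ← Real.exp_add]
          congr 1
          ring
        linear_combination (Real.pi * (1 - Real.exp (-2))) ^ 2 * this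
    _ = ∫⁻ z in expAnnulus x ×ˢ expAnnulus y, ENNReal.ofReal L := (setLIntegral_const _ _).symm
    _ ≤ _ := by
        refine setLIntegral_mono' ((measurableSet_expAnnulus x).prod (measurableSet_expAnnulus y)) ?_
        rintro z ⟨hz1, hz2⟩
        obtain ⟨n1, l1, u1⟩ := mem_expAnnulus hz1
        obtain ⟨n2, l2, u2⟩ := mem_expAnnulus hz2
        have p1 : 0 < ‖z.1‖ := norm_pos_iff.2 n1
        have p2 : 0 < ‖z.2‖ := norm_pos_iff.2 n2
        have hz : z ∈ unitPolydisk :=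
          ⟨(Real.log_neg_iff p1).1 (by linarith), (Real.log_neg_iff p2).1 (by linarith)⟩
        rw [hφ.multDensity_eq c _ ⟨hz, n1, n2⟩, ← ofReal_norm, ← ENNReal.ofReal_pow (by positivity),
          ← ENNReal.ofReal_mul (by positivity)]
        refine ENNReal.ofReal_le_ofReal ?_
        have hpow : ∀ {x : ℝ} (n : ℕ), 0 < x → x ^ n = Real.exp (Real.log x * n) := fun n hx => by
          rw [← Real.rpow_natCast, Real.rpow_def_of_pos hx]
        rw [monom, norm_mul, norm_pow, norm_pow, hpow a p1, hpow b p2, toricWeight, ← Real.exp_add,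
          ← Real.exp_nat_mul, ← Real.exp_add, hL, Real.exp_le_exp]
        have h1 := hφ.monotoneOn_hat (log_mem_negQuadrant hz n1 n2) (b := (x, y)) ⟨hx, hy⟩
          ⟨u1.le, u2.le⟩
        have h2 := mul_le_mul_of_nonneg_left h1 hc.le
        have h3 := mul_le_mul_of_nonneg_left l1.le (by positivity : (0:ℝ) ≤ 2 * a)
        have h4 := mul_le_mul_of_nonneg_left l2.le (by positivity : (0:ℝ) ≤ 2 * b)
        push_cast
        linarith

/-- By absolute continuity, the integral over products of annuli of small volume is small. The lower
bound on such products then makes the exponent exceed its corner value by `1` far away, which is the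
growth condition. -/
theorem mem_diagInterior_of_isMultIntegrable (hφ : IsToricPsh φ) {c : ℝ} (hc : 0 < c) {a b : ℕ}
    (h : IsMultIntegrable (fun z => (c : EReal) * φ z) 0 (monom a b)) :
    ((a + 1) / c, (b + 1) / c) ∈ diagInterior (linearMinorants φ) := by
  obtain ⟨U, hU, -, hint⟩ := h
  obtain ⟨r, hr, hrU⟩ := Metric.mem_nhds_iff.1 hU
  set T := min (Real.log r) (-1) with hT
  have hTr : T ≤ Real.log r := min_le_left _ _
  have hT1 : T ≤ -1 := min_le_right _ _
  have he : 0 < 1 - Real.exp (-2) := by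
    rw [sub_pos, Real.exp_lt_one_iff]
    norm_num
  set κ := Real.exp (-(2 * a + 2 * b)) * (Real.pi * (1 - Real.exp (-2))) ^ 2 with hκ
  have hκ0 : 0 < κ := by positivity
  set K := c * hat φ (T, T) - (a + 1) * T - (b + 1) * T + 1 with hK
  obtain ⟨δ, hδ, hsmall⟩ := exists_pos_setLIntegral_lt_of_measure_lt hint.ne
    (ε := ENNReal.ofReal (κ * Real.exp (-(2 * K)))) (by simp; positivity)
  have hlim : Tendsto (fun s : ℝ => ENNReal.ofReal ((Real.pi * (1 - Real.exp (-2))) ^ 2 *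
      Real.exp (2 * s))) atBot (𝓝 0) := by
    have h1 : Tendsto (fun s : ℝ => Real.exp (2 * s)) atBot (𝓝 0) :=
      Real.tendsto_exp_atBot.comp (tendsto_id.const_mul_atBot two_pos)
    have h2 := h1.const_mul ((Real.pi * (1 - Real.exp (-2))) ^ 2)
    rw [mul_zero] at h2
    simpa using ENNReal.tendsto_ofReal h2
  obtain ⟨N, hN⟩ := eventually_atBot.1 (hlim.eventually_lt_const hδ)
  refine hφ.mem_diagInterior_of_growth (T := T) (N := -N) hc (by simp) (by simp) (by linarith) ?_
  intro x y hx hy hxy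
  rw [neg_neg] at hxy
  set B := expAnnulus x ×ˢ expAnnulus y with hB
  have hBU : B ⊆ U := by
    rintro z ⟨hz1, hz2⟩
    refine hrU ?_
    have hlt : ∀ {w : ℂ} {s : ℝ}, s ≤ T → w ∈ expAnnulus s → ‖w‖ < r := by
      intro w s hs hw
      have : ‖w‖ < Real.exp s := by simpa using hw.1
      exact this.trans_le ((Real.exp_le_exp.2 (hs.trans hTr)).trans (Real.exp_log hr).le)
    rw [mem_ball_zero_iff, Prod.norm_def]
    exact max_lt (hlt hx hz1) (hlt hy hz2)
  have hBm : MeasurableSet B := (measurableSet_expAnnulus x).prod (measurableSet_expAnnulus y)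
  have hvol : (volume.restrict U) B < δ := by
    refine (Measure.restrict_apply_le _ _).trans_lt ((le_of_eq ?_).trans_lt (hN (x + y) hxy))
    rw [hB, Measure.volume_eq_prod, Measure.prod_prod, volume_expAnnulus, volume_expAnnulus,
      ← ENNReal.ofReal_mul (by positivity)]
    congr 1
    rw [mul_add, Real.exp_add]
    ring
  have h1 := hsmall B hvol
  rw [Measure.restrict_restrict hBm, inter_eq_left.2 hBU] at h1
  have h2 := (hφ.le_lintegral_expAnnulus hc a b (lt_of_le_of_lt hx (by linarith))
    (lt_of_le_of_lt hy (by linarith))).trans_lt h1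
  rw [ENNReal.ofReal_lt_ofReal_iff (by positivity), mul_lt_mul_iff_right₀ hκ0,
    Real.exp_lt_exp] at h2
  linarith

theorem isMultIntegrable_monom_iff (hφ : IsToricPsh φ) {c : ℝ} (hc : 0 < c) {a b : ℕ} :
    IsMultIntegrable (fun z => (c : EReal) * φ z) 0 (monom a b) ↔
      ((a + 1) / c, (b + 1) / c) ∈ diagInterior (linearMinorants φ) :=
  ⟨hφ.mem_diagInterior_of_isMultIntegrable hc, hφ.isMultIntegrable_monom hc⟩

end IsToricPsh

/-! ### Double power series -/

theorem norm_monom_le {a b : ℕ} {ρ : ℝ} {z : ℂ × ℂ} (hz : ‖z‖ ≤ ρ) :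
    ‖monom a b z‖ ≤ ρ ^ (a + b) := by
  have h1 : ‖z.1‖ ≤ ρ := (norm_fst_le z).trans hz
  have h2 : ‖z.2‖ ≤ ρ := (norm_snd_le z).trans hz
  have hρ : 0 ≤ ρ := (norm_nonneg z).trans hz
  rw [monom, norm_mul, norm_pow, norm_pow, pow_add]
  gcongr

theorem monom_add (a b a' b' : ℕ) (z : ℂ × ℂ) :
    monom (a + a') (b + b') z = monom a b z * monom a' b' z := by
  simp only [monom]
  ring

/-- Multilinear expansion of `z = z₁ (1, 0) + z₂ (0, 1)`; the subset `s` records the slots that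
receive the first vector. -/
theorem map_diag_eq_sum {n : ℕ} (f : ContinuousMultilinearMap ℂ (fun _ : Fin n => ℂ × ℂ) ℂ)
    (z : ℂ × ℂ) : f (fun _ => z) = ∑ s : Finset (Fin n),
      f (s.piecewise (fun _ => (1, 0)) fun _ => (0, 1)) * monom s.card (n - s.card) z := by
  have h : (fun _ : Fin n => z) = (fun _ => z.1 • ((1, 0) : ℂ × ℂ)) + fun _ => z.2 • (0, 1) := by
    funext i
    ext <;> simp
  rw [h, f.map_add_univ]
  refine Finset.sum_congr rfl fun s _ => ?_
  have h2 : s.piecewise (fun _ : Fin n => z.1 • ((1, 0) : ℂ × ℂ)) (fun _ => z.2 • (0, 1)) =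
      fun i => s.piecewise (fun _ => z.1) (fun _ => z.2) i •
        s.piecewise (fun _ => ((1, 0) : ℂ × ℂ)) (fun _ => (0, 1)) i := by
    funext i
    by_cases hi : i ∈ s <;> simp [hi]
  rw [h2, f.map_smul_univ, Finset.prod_piecewise]
  simp [monom, Finset.card_sdiff, mul_comm]

/-- An analytic function of two variables is the sum of an absolutely convergent double power
series near `0`. -/
theorem AnalyticAt.exists_double_series {u : ℂ × ℂ → ℂ} (hu : AnalyticAt ℂ u 0) :
    ∃ (a : ℕ × ℕ → ℂ) (ρ : ℝ), 0 < ρ ∧ (Summable fun α => ‖a α‖ * ρ ^ (α.1 + α.2)) ∧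
      ∀ z : ℂ × ℂ, ‖z‖ ≤ ρ → HasSum (fun α => a α * monom α.1 α.2 z) (u z) := by
  obtain ⟨p, R, hp⟩ := hu
  obtain ⟨r, hr0, hrR⟩ := ENNReal.lt_iff_exists_nnreal_btwn.1 hp.r_pos
  have hr0 : 0 < (r : ℝ) := by exact_mod_cast hr0
  have hsum := p.summable_norm_mul_pow (hrR.trans_le hp.r_le)
  -- Halving the radius absorbs the `2 ^ n` subsets in degree `n`.
  set ρ : ℝ := r / 2 with hρ
  have hρ0 : 0 < ρ := by positivity
  set e : ∀ n, Finset (Fin n) → Fin n → ℂ × ℂ := fun n s =>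
    s.piecewise (fun _ => (1, 0)) fun _ => (0, 1) with he
  set c : (Σ n, Finset (Fin n)) → ℂ := fun x => p x.1 (e x.1 x.2) with hc
  have hcle : ∀ x, ‖c x‖ ≤ ‖p x.1‖ := by
    intro x
    refine ((p x.1).le_opNorm _).trans ?_
    refine mul_le_of_le_one_right (norm_nonneg _) (Finset.prod_le_one (fun _ _ => norm_nonneg _) ?_)
    intro i _
    by_cases hi : i ∈ x.2 <;> simp [he, hi, Prod.norm_def]
  have hcs : Summable fun x => ‖c x‖ * ρ ^ x.1 := by
    rw [summable_sigma_of_nonneg fun x => by positivity]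
    refine ⟨fun n => Summable.of_finite, ?_⟩
    refine Summable.of_nonneg_of_le (fun n => tsum_nonneg fun s => by positivity) (fun n => ?_) hsum
    rw [tsum_fintype]
    calc ∑ s : Finset (Fin n), ‖c ⟨n, s⟩‖ * ρ ^ n
        ≤ ∑ s : Finset (Fin n), ‖p n‖ * ρ ^ n := by
          refine Finset.sum_le_sum fun s _ => ?_
          gcongr
          exact hcle ⟨n, s⟩
      _ = ‖p n‖ * r ^ n := by
          rw [Finset.sum_const, Finset.card_univ, Fintype.card_finset, Fintype.card_fin, hρ, div_pow,
            nsmul_eq_mul]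
          push_cast
          field_simp
  set d : (Σ n, Finset (Fin n)) → ℕ × ℕ := fun x => (x.2.card, x.1 - x.2.card) with hd
  have hdn : ∀ x, (d x).1 + (d x).2 = x.1 := fun x => by
    have : x.2.card ≤ x.1 := by simpa using x.2.card_le_univ
    simp only [hd]
    omega
  have hfib : Summable fun y : Σ α, {x // d x = α} => ‖c y.2.1‖ * ρ ^ (y.1.1 + y.1.2) := by
    refine ((Equiv.sigmaFiberEquiv d).summable_iff.2 hcs).congr fun y => ?_
    obtain ⟨α, x, hx⟩ := y
    subst hx
    simp only [hdn]
    rfl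
  obtain ⟨hf1, hf2⟩ := (summable_sigma_of_nonneg fun y => by positivity).1 hfib
  have hn : ∀ α, Summable fun x : {x // d x = α} => ‖c x.1‖ := fun α => by
    have := hf1 α
    simp only at this
    exact (summable_mul_right_iff (by positivity)).1 this
  refine ⟨fun α => ∑' x : {x // d x = α}, c x.1, ρ, hρ0, ?_, fun z hz => ?_⟩
  · refine Summable.of_nonneg_of_le (fun α => by positivity) (fun α => ?_) hf2
    simp only
    rw [tsum_mul_right]
    gcongr
    exact norm_tsum_le_tsum_norm (hn α)
  · have hzR : z ∈ Metric.eball (0 : ℂ × ℂ) R := by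
      rw [Metric.mem_eball, edist_zero_right]
      refine lt_trans ?_ hrR
      rw [← ofReal_norm]
      refine (ENNReal.ofReal_lt_iff_lt_toReal (norm_nonneg _) ENNReal.coe_ne_top).2 ?_
      rw [ENNReal.coe_toReal]
      linarith
    have h1 := hp.hasSum hzR
    rw [zero_add] at h1
    have hterm : Summable fun x => c x * monom (d x).1 (d x).2 z := by
      refine Summable.of_norm_bounded hcs fun x => ?_
      rw [norm_mul, ← hdn x]
      gcongr
      exact norm_monom_le hz
    -- Summation by degree gives `u z`; absolute convergence then permits regrouping by bidegree,
    -- along the fibres of `d`.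
    have h2 : HasSum (fun x => c x * monom (d x).1 (d x).2 z) (u z) := by
      have h3 := hterm.hasSum
      have h4 := h3.sigma (fun n => hasSum_fintype _)
      have h5 : (fun n => ∑ s, c ⟨n, s⟩ * monom (d ⟨n, s⟩).1 (d ⟨n, s⟩).2 z) =
          fun n => p n fun _ => z := by
        funext n
        rw [map_diag_eq_sum]
      rw [h5] at h4
      rw [h1.unique h4]
      exact h3
    have h3 := (Equiv.sigmaFiberEquiv d).hasSum_iff.2 h2
    have h4 : HasSum (fun y : Σ α, {x // d x = α} => c y.2.1 * monom y.1.1 y.1.2 z) (u z) := by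
      refine h3.congr_fun fun y => ?_
      obtain ⟨α, x, hx⟩ := y
      subst hx
      rfl
    refine HasSum.sigma (g := fun α => (∑' x : {x // d x = α}, c x.1) * monom α.1 α.2 z) h4
      fun α => ?_
    exact ((hn α).of_norm.hasSum).mul_right (monom α.1 α.2 z)

/-! ### Averages over roots of unity -/

/-- Orthogonality of characters of `ℤ/N`, as a geometric sum. -/
theorem IsPrimitiveRoot.sum_pow_eq {N : ℕ} {ω : ℂ} (hω : IsPrimitiveRoot ω N) {k m : ℕ}
    (hk : k < N) : ∑ i ∈ Finset.range N, (ω ^ m * (ω⁻¹) ^ k) ^ i = if m % N = k then (N : ℂ) else 0 := by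
  have hω0 : ω ≠ 0 := hω.ne_zero (by omega)
  have hx : ω ^ m * (ω⁻¹) ^ k = 1 ↔ m % N = k := by
    rw [inv_pow, mul_inv_eq_one₀ (pow_ne_zero _ hω0)]
    constructor
    · intro h
      rw [← pow_mod_orderOf ω m, ← hω.eq_orderOf] at h
      exact hω.pow_inj (Nat.mod_lt _ (by omega)) hk h
    · intro h
      rw [← h, ← pow_mod_orderOf ω m, ← hω.eq_orderOf]
  split_ifs with h
  · rw [hx.2 h]
    simp
  · have h1 : ω ^ m * (ω⁻¹) ^ k - 1 ≠ 0 := fun h0 => h (hx.1 (sub_eq_zero.1 h0))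
    have h2 := geom_sum_mul (ω ^ m * (ω⁻¹) ^ k) N
    have h3 : (ω ^ m * (ω⁻¹) ^ k) ^ N = 1 := by
      rw [mul_pow, ← pow_mul, ← pow_mul, mul_comm m, mul_comm k, pow_mul, pow_mul, inv_pow,
        hω.pow_eq_one]
      simp
    rw [h3, sub_self] at h2
    exact (mul_eq_zero.1 h2).resolve_right h1

/-- The rotation `(z₁, z₂) ↦ (ω₁ z₁, ω₂ z₂)`. -/
def torusRotation (ω₁ ω₂ : ℂ) (z : ℂ × ℂ) : ℂ × ℂ := (ω₁ * z.1, ω₂ * z.2)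

theorem monom_torusRotation (ω₁ ω₂ : ℂ) (a b : ℕ) (z : ℂ × ℂ) :
    monom a b (torusRotation ω₁ ω₂ z) = ω₁ ^ a * ω₂ ^ b * monom a b z := by
  simp only [monom, torusRotation]
  ring

theorem norm_torusRotation {ω₁ ω₂ : ℂ} (h1 : ‖ω₁‖ = 1) (h2 : ‖ω₂‖ = 1) (z : ℂ × ℂ) :
    ‖torusRotation ω₁ ω₂ z‖ = ‖z‖ := by
  simp [torusRotation, Prod.norm_def, h1, h2]

theorem analyticAt_comp_torusRotation {u : ℂ × ℂ → ℂ} (hu : AnalyticAt ℂ u 0) (ω₁ ω₂ : ℂ) :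
    AnalyticAt ℂ (fun z => u (torusRotation ω₁ ω₂ z)) 0 := by
  have h : AnalyticAt ℂ (torusRotation ω₁ ω₂) 0 :=
    (analyticAt_const.mul analyticAt_fst).prod (analyticAt_const.mul analyticAt_snd)
  refine AnalyticAt.fun_comp (g := u) ?_ h
  have e : torusRotation ω₁ ω₂ 0 = 0 := by ext <;> simp [torusRotation]
  rwa [e]

/-- A finite average of rotations of `u` isolates a monomial of `u`. -/
theorem AnalyticAt.exists_norm_monom_le {u : ℂ × ℂ → ℂ} {a : ℕ × ℕ → ℂ} {ρ : ℝ} (hρ : 0 < ρ)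
    (ha : Summable fun α => ‖a α‖ * ρ ^ (α.1 + α.2))
    (hu : ∀ z : ℂ × ℂ, ‖z‖ ≤ ρ → HasSum (fun α => a α * monom α.1 α.2 z) (u z))
    {α : ℕ × ℕ} (hα : a α ≠ 0) : ∃ (N : ℕ) (ω : ℂ) (C : ℝ), 0 < N ∧ ‖ω‖ = 1 ∧ ∀ᶠ z in 𝓝 0,
      ∃ i ∈ Finset.range N ×ˢ Finset.range N, ‖monom α.1 α.2 z‖ ≤
        C * ‖u (torusRotation (ω ^ i.1) (ω ^ i.2) z)‖ := by
  obtain ⟨k, l⟩ := α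
  set N := k + l + 1 with hN
  have hN0 : (N : ℂ) ≠ 0 := Nat.cast_ne_zero.2 (by omega)
  have hω := Complex.isPrimitiveRoot_exp N (by omega)
  set ω := Complex.exp (2 * Real.pi * Complex.I / N)
  have hω1 : ‖ω‖ = 1 := hω.norm'_eq_one (by omega)
  set A := ∑' α, ‖a α‖ * ρ ^ (α.1 + α.2) with hA
  refine ⟨N, ω, 2 * N ^ 2 / ‖a (k, l)‖, by omega, hω1, ?_⟩
  have hna : 0 < ‖a (k, l)‖ := norm_pos_iff.2 hα
  have hsmall : ∀ᶠ z : ℂ × ℂ in 𝓝 0, ‖z‖ * (A / ρ ^ (k + l + 1)) < ‖a (k, l)‖ / 2 := by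
    have : ContinuousAt (fun z : ℂ × ℂ => ‖z‖ * (A / ρ ^ (k + l + 1))) 0 := by fun_prop
    exact this.eventually_lt_const (by simpa using hna)
  have hball : ∀ᶠ z : ℂ × ℂ in 𝓝 0, ‖z‖ < ρ := by
    have : ContinuousAt (fun z : ℂ × ℂ => ‖z‖) 0 := by fun_prop
    exact this.eventually_lt_const (by simpa using hρ)
  filter_upwards [hsmall, hball] with z hz hzρ
  set I := Finset.range N ×ˢ Finset.range N with hI
  set w : ℕ × ℕ → ℂ := fun i => (ω⁻¹) ^ (k * i.1) * (ω⁻¹) ^ (l * i.2) with hw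
  have hnw : ∀ i, ‖w i‖ = 1 := fun i => by simp [hw, hω1]
  have hrot : ∀ i : ℕ × ℕ, HasSum (fun β => w i * (a β * monom β.1 β.2
      (torusRotation (ω ^ i.1) (ω ^ i.2) z))) (w i * u (torusRotation (ω ^ i.1) (ω ^ i.2) z)) := by
    intro i
    refine (hu _ ?_).mul_left _
    rw [norm_torusRotation (by simp [hω1]) (by simp [hω1])]
    exact hzρ.le
  have hv := hasSum_sum (s := I) fun i _ => hrot i
  set v := ∑ i ∈ I, w i * u (torusRotation (ω ^ i.1) (ω ^ i.2) z) with hvdef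
  have hcoef : ∀ β : ℕ × ℕ, ∑ i ∈ I, w i * (a β * monom β.1 β.2
      (torusRotation (ω ^ i.1) (ω ^ i.2) z)) =
      if β.1 % N = k ∧ β.2 % N = l then (N : ℂ) ^ 2 * (a β * monom β.1 β.2 z) else 0 := by
    intro β
    have h1 : ∀ i : ℕ × ℕ, w i * (a β * monom β.1 β.2 (torusRotation (ω ^ i.1) (ω ^ i.2) z)) =
        ((ω ^ β.1 * (ω⁻¹) ^ k) ^ i.1 * (ω ^ β.2 * (ω⁻¹) ^ l) ^ i.2) * (a β * monom β.1 β.2 z) := by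
      intro i
      rw [monom_torusRotation]
      simp only [hw, mul_pow, ← pow_mul]
      rw [mul_comm i.1 β.1, mul_comm i.2 β.2]
      ring
    simp only [h1]
    rw [← Finset.sum_mul, hI, Finset.sum_product]
    simp only
    rw [← Finset.sum_mul_sum, hω.sum_pow_eq (by omega), hω.sum_pow_eq (by omega)]
    by_cases h1 : β.1 % N = k <;> by_cases h2 : β.2 % N = l <;> simp [h1, h2, sq]
  simp only [hcoef] at hv
  -- The other surviving exponents are congruent to `(k, l)` and dominate it strictly, so each such
  -- term carries an extra factor `‖z‖`; near `0` their sum is at most half the main term.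
  have hdiff := hv.sub (hasSum_ite_eq (k, l) ((N : ℂ) ^ 2 * (a (k, l) * monom k l z)))
  have hbound := hdiff.norm_le_of_bounded
    (ha.hasSum.mul_left ((N : ℝ) ^ 2 * (‖monom k l z‖ * ‖z‖ / ρ ^ (k + l + 1)))) (fun β => by
      by_cases hβ : β = (k, l)
      · subst hβ
        rw [if_pos ⟨Nat.mod_eq_of_lt (by omega), Nat.mod_eq_of_lt (by omega)⟩, if_pos rfl, sub_self,
          norm_zero]
        positivity
      rw [if_neg hβ, sub_zero]
      split_ifs with h
      · obtain ⟨x, y⟩ := β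
        have hkx : k ≤ x := by rw [← h.1]; exact Nat.mod_le _ _
        have hly : l ≤ y := by rw [← h.2]; exact Nat.mod_le _ _
        obtain ⟨x', rfl⟩ := Nat.exists_eq_add_of_le hkx
        obtain ⟨y', rfl⟩ := Nat.exists_eq_add_of_le hly
        have hxy : x' + y' ≠ 0 := fun h0 => hβ (by
          ext <;> simp <;> omega)
        obtain ⟨n, hn⟩ := Nat.exists_eq_succ_of_ne_zero hxy
        have h1 : ‖monom x' y' z‖ ≤ ‖z‖ * ρ ^ n := by
          refine (norm_monom_le le_rfl).trans ?_
          rw [hn, pow_succ, mul_comm]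
          gcongr
        rw [monom_add, norm_mul, norm_mul, norm_mul, norm_pow, Complex.norm_natCast]
        have h2 : ρ ^ (k + x' + (l + y')) = ρ ^ (k + l + 1) * ρ ^ n := by
          rw [← pow_add]
          congr 1
          omega
        simp only
        rw [h2]
        calc (N : ℝ) ^ 2 * (‖a (k + x', l + y')‖ * (‖monom k l z‖ * ‖monom x' y' z‖))
            ≤ (N : ℝ) ^ 2 * (‖a (k + x', l + y')‖ * (‖monom k l z‖ * (‖z‖ * ρ ^ n))) := by gcongr
          _ = _ := by field_simp
      · rw [norm_zero]
        positivity)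
  rw [← hA] at hbound
  have hlow : (N : ℝ) ^ 2 * (‖monom k l z‖ * ‖a (k, l)‖ / 2) ≤ ‖v‖ := by
    have h1 : ‖(N : ℂ) ^ 2 * (a (k, l) * monom k l z)‖ =
        (N : ℝ) ^ 2 * (‖monom k l z‖ * ‖a (k, l)‖) := by
      rw [norm_mul, norm_mul, norm_pow, Complex.norm_natCast, mul_comm ‖a (k, l)‖]
    have h2 := norm_sub_norm_le ((N : ℂ) ^ 2 * (a (k, l) * monom k l z)) v
    rw [norm_sub_rev, h1] at h2
    have h3 : (N : ℝ) ^ 2 * (‖monom k l z‖ * ‖z‖ / ρ ^ (k + l + 1)) * A =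
        (N : ℝ) ^ 2 * ‖monom k l z‖ * (‖z‖ * (A / ρ ^ (k + l + 1))) := by ring
    rw [h3] at hbound
    have h4 := mul_le_mul_of_nonneg_left hz.le (by positivity : 0 ≤ (N : ℝ) ^ 2 * ‖monom k l z‖)
    linarith
  have hIne : I.Nonempty := by
    simp [hI, hN]
  have hIcard : (I.card : ℝ) = (N : ℝ) ^ 2 := by simp [hI, sq]
  obtain ⟨i, hi, hmax⟩ := I.exists_max_image
    (fun i => ‖u (torusRotation (ω ^ i.1) (ω ^ i.2) z)‖) hIne
  refine ⟨i, hi, ?_⟩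
  have hup : ‖v‖ ≤ (N : ℝ) ^ 2 * ‖u (torusRotation (ω ^ i.1) (ω ^ i.2) z)‖ := by
    refine (norm_sum_le _ _).trans ?_
    rw [← hIcard, ← nsmul_eq_mul]
    refine Finset.sum_le_card_nsmul _ _ _ fun j hj => ?_
    rw [norm_mul, hnw, one_mul]
    exact hmax j hj
  have hNr : (0 : ℝ) < (N : ℝ) ^ 2 := by
    have : 0 < N := by omega
    positivity
  have h5 := le_of_mul_le_mul_left (hlow.trans hup) hNr
  have hN1 : (1 : ℝ) ≤ (N : ℝ) ^ 2 := by
    have : (1 : ℝ) ≤ N := by exact_mod_cast (by omega : 1 ≤ N)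
    nlinarith
  rw [div_mul_eq_mul_div, le_div_iff₀ hna]
  nlinarith [norm_nonneg (u (torusRotation (ω ^ i.1) (ω ^ i.2) z))]

/-! ### Multiplier ideals of toric plurisubharmonic functions are monomial -/

theorem measurePreserving_torusRotation {ω₁ ω₂ : ℂ} (h1 : ‖ω₁‖ = 1) (h2 : ‖ω₂‖ = 1) :
    MeasurePreserving (torusRotation ω₁ ω₂) := by
  have h : ∀ {ω : ℂ}, ‖ω‖ = 1 → MeasurePreserving (fun z : ℂ => ω * z) := fun {ω} hω =>
    (rotation ⟨ω, mem_sphere_zero_iff_norm.2 hω⟩).measurePreserving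
  exact (h h1).prod (h h2)

theorem measurableEmbedding_torusRotation {ω₁ ω₂ : ℂ} (h1 : ‖ω₁‖ = 1) (h2 : ‖ω₂‖ = 1) :
    MeasurableEmbedding (torusRotation ω₁ ω₂) := by
  have hc : ∀ a b : ℂ, Continuous (torusRotation a b) := fun a b => by
    unfold torusRotation
    fun_prop
  have n1 : ω₁ ≠ 0 := norm_ne_zero_iff.1 (by rw [h1]; exact one_ne_zero)
  have n2 : ω₂ ≠ 0 := norm_ne_zero_iff.1 (by rw [h2]; exact one_ne_zero)
  refine MeasurableEmbedding.of_measurable_inverse (g := torusRotation ω₁⁻¹ ω₂⁻¹)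
    (hc _ _).measurable ?_ (hc _ _).measurable fun z => ?_
  · have : range (torusRotation ω₁ ω₂) = univ := range_eq_univ.2 fun z =>
      ⟨torusRotation ω₁⁻¹ ω₂⁻¹ z, by ext <;> simp [torusRotation, n1, n2]⟩
    rw [this]
    exact MeasurableSet.univ
  · ext <;> simp [torusRotation, n1, n2]

/-- Dickson's lemma: the minimal elements form an antichain in a well-quasi-order. -/
theorem exists_finset_minimal (S : Set (ℕ × ℕ)) :
    ∃ G : Finset (ℕ × ℕ), (∀ g ∈ G, g ∈ S) ∧ ∀ β ∈ S, ∃ g ∈ G, g ≤ β := by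
  have hf : {x | Minimal (· ∈ S) x}.Finite :=
    WellQuasiOrderedLE.finite_of_isAntichain (setOfPred_minimal_antichain _)
  refine ⟨hf.toFinset, fun g hg => (hf.mem_toFinset.1 hg).1, fun β hβ => ?_⟩
  obtain ⟨g, hg, hmin⟩ := exists_minimal_le_of_wellFoundedLT (· ∈ S) β hβ
  exact ⟨g, hf.mem_toFinset.2 hmin, hg⟩

namespace IsToricPsh

variable {φ : ℂ × ℂ → EReal}

theorem apply_torusRotation (hφ : IsToricPsh φ) {ω₁ ω₂ : ℂ} (h1 : ‖ω₁‖ = 1) (h2 : ‖ω₂‖ = 1)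
    {z : ℂ × ℂ} (hz : z ∈ unitPolydisk) : φ (torusRotation ω₁ ω₂ z) = φ z := by
  have hz' : torusRotation ω₁ ω₂ z ∈ unitPolydisk := by
    simpa [torusRotation, unitPolydisk, h1, h2] using hz
  rw [hφ.toric z hz, hφ.toric _ hz']
  simp [torusRotation, h1, h2]

theorem isMultIntegrable_comp_torusRotation (hφ : IsToricPsh φ) {c : ℝ} {u : ℂ × ℂ → ℂ}
    (hu : AnalyticAt ℂ u 0) (hI : IsMultIntegrable (fun z => (c : EReal) * φ z) 0 u)
    {ω₁ ω₂ : ℂ} (h1 : ‖ω₁‖ = 1) (h2 : ‖ω₂‖ = 1) :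
    IsMultIntegrable (fun z => (c : EReal) * φ z) 0 fun z => u (torusRotation ω₁ ω₂ z) := by
  obtain ⟨U, hU, -, hint⟩ := hI
  have han := analyticAt_comp_torusRotation hu ω₁ ω₂
  have hcont : Continuous (torusRotation ω₁ ω₂) := by
    unfold torusRotation
    fun_prop
  have hU' : ∀ᶠ z in 𝓝 (0 : ℂ × ℂ), torusRotation ω₁ ω₂ z ∈ U := by
    have h0 : torusRotation ω₁ ω₂ 0 = 0 := by ext <;> simp [torusRotation]
    exact hcont.continuousAt.eventually (by rwa [h0])
  have hD : ∀ᶠ z in 𝓝 (0 : ℂ × ℂ), z ∈ unitPolydisk := unitPolydisk_mem_nhds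
  obtain ⟨V, hV, hVo, h0⟩ := mem_nhds_iff.1 (hU'.and (hD.and han.eventually_analyticAt))
  refine ⟨V, hVo.mem_nhds h0, hφ.aemeasurable_multDensity c hVo (fun z hz => (hV hz).2.1)
    fun z hz => (hV hz).2.2.continuousAt.continuousWithinAt, lt_of_le_of_lt ?_ hint⟩
  rw [← (measurePreserving_torusRotation h1 h2).setLIntegral_comp_preimage_emb
    (measurableEmbedding_torusRotation h1 h2) (multDensity (fun z => (c : EReal) * φ z) u) U]
  refine (setLIntegral_mono' hVo.measurableSet fun z hz => ?_).trans
    (lintegral_mono_set fun z hz => (hV hz).1)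
  simp only [multDensity]
  rw [hφ.apply_torusRotation h1 h2 (hV hz).2.1]

theorem isMultIntegrable_congr (hφ : IsToricPsh φ) {c : ℝ} {u v : ℂ × ℂ → ℂ}
    (hv : AnalyticAt ℂ v 0) (huv : u =ᶠ[𝓝 0] v)
    (h : IsMultIntegrable (fun z => (c : EReal) * φ z) 0 u) :
    IsMultIntegrable (fun z => (c : EReal) * φ z) 0 v :=
  hφ.isMultIntegrable_of_dominated {()} (v := fun _ => u) (C := 1) hv (fun _ _ => h) <| by
    filter_upwards [huv] with z hz
    exact ⟨(), by simp, by simp [hz]⟩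

/-- The multiplier ideal contains the monomials of its members. -/
theorem isMultIntegrable_monom_of_coeff_ne_zero (hφ : IsToricPsh φ) {c : ℝ} {u : ℂ × ℂ → ℂ}
    (han : AnalyticAt ℂ u 0) {a : ℕ × ℕ → ℂ} {ρ : ℝ} (hρ : 0 < ρ)
    (ha : Summable fun α => ‖a α‖ * ρ ^ (α.1 + α.2))
    (hu : ∀ z : ℂ × ℂ, ‖z‖ ≤ ρ → HasSum (fun α => a α * monom α.1 α.2 z) (u z))
    (hI : IsMultIntegrable (fun z => (c : EReal) * φ z) 0 u) {α : ℕ × ℕ} (hα : a α ≠ 0) :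
    IsMultIntegrable (fun z => (c : EReal) * φ z) 0 (monom α.1 α.2) := by
  obtain ⟨N, ω, C, -, hω, hle⟩ := AnalyticAt.exists_norm_monom_le hρ ha hu hα
  exact hφ.isMultIntegrable_of_dominated (Finset.range N ×ˢ Finset.range N)
    (v := fun i z => u (torusRotation (ω ^ i.1) (ω ^ i.2) z)) (analyticAt_monom α.1 α.2 0)
    (fun i _ => hφ.isMultIntegrable_comp_torusRotation han hI (ω₁ := ω ^ i.1) (ω₂ := ω ^ i.2)
      (by simp [hω]) (by simp [hω])) hle

/-- A germ all of whose monomials are in the multiplier ideal is in it. -/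
theorem isMultIntegrable_of_monoms (hφ : IsToricPsh φ) {c : ℝ} {u : ℂ × ℂ → ℂ}
    (han : AnalyticAt ℂ u 0) {a : ℕ × ℕ → ℂ} {ρ : ℝ} (hρ : 0 < ρ)
    (ha : Summable fun α => ‖a α‖ * ρ ^ (α.1 + α.2))
    (hu : ∀ z : ℂ × ℂ, ‖z‖ ≤ ρ → HasSum (fun α => a α * monom α.1 α.2 z) (u z))
    (hI : ∀ α : ℕ × ℕ, a α ≠ 0 → IsMultIntegrable (fun z => (c : EReal) * φ z) 0 (monom α.1 α.2)) :
    IsMultIntegrable (fun z => (c : EReal) * φ z) 0 u := by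
  obtain ⟨G, hGS, hG⟩ := exists_finset_minimal {α | a α ≠ 0}
  have hball : ∀ᶠ z : ℂ × ℂ in 𝓝 0, ‖z‖ < ρ := by
    have : ContinuousAt (fun z : ℂ × ℂ => ‖z‖) 0 := by fun_prop
    exact this.eventually_lt_const (by simpa using hρ)
  rcases G.eq_empty_or_nonempty with rfl | hne
  · have ha0 : ∀ α, a α = 0 := fun α => by
      by_contra h
      obtain ⟨g, hg, -⟩ := hG α h
      simp at hg
    refine hφ.isMultIntegrable_congr (u := fun _ => 0) han ?_ ⟨univ, univ_mem, ?_⟩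
    · filter_upwards [hball] with z hz
      refine (HasSum.unique (hu z hz.le) ?_).symm
      simp [ha0]
    · have h : multDensity (fun z => (c : EReal) * φ z) (fun _ => 0) = fun _ => 0 := by
        funext z
        simp [multDensity]
      simp [h]
  -- Monomials normalised to the polydisk of radius `ρ`: every monomial of `u` is at most `ρ^{|β|}`
  -- times the largest `|w g z|`, whence `|u| ≤ A max |w g|`.
  set w : ℕ × ℕ → ℂ × ℂ → ℂ := fun g z => (ρ : ℂ)⁻¹ ^ (g.1 + g.2) * monom g.1 g.2 z with hw
  set A := ∑' α, ‖a α‖ * ρ ^ (α.1 + α.2) with hA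
  refine hφ.isMultIntegrable_of_dominated G (v := w) (C := A) han (fun g hg => ?_) ?_
  · exact (hI g (hGS g hg)).mul_left (h := fun _ => (ρ : ℂ)⁻¹ ^ (g.1 + g.2)) analyticAt_const
  · filter_upwards [hball] with z hz
    obtain ⟨g, hg, hmax⟩ := G.exists_max_image (fun g => ‖w g z‖) hne
    refine ⟨g, hg, ?_⟩
    refine (hu z hz.le).norm_le_of_bounded (ha.hasSum.mul_right _) fun β => ?_
    by_cases hβ : a β = 0
    · simp [hβ]
    obtain ⟨m, hm, hmβ⟩ := hG β hβ
    obtain ⟨x, y⟩ := β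
    obtain ⟨k, l⟩ := m
    obtain ⟨x', rfl⟩ := Nat.exists_eq_add_of_le hmβ.1
    obtain ⟨y', rfl⟩ := Nat.exists_eq_add_of_le hmβ.2
    simp only
    rw [norm_mul, mul_assoc]
    gcongr
    have hwm : ‖monom k l z‖ = ρ ^ (k + l) * ‖w (k, l) z‖ := by
      simp only [hw]
      rw [norm_mul, norm_pow, norm_inv, Complex.norm_real, Real.norm_of_nonneg hρ.le, ← mul_assoc,
        ← mul_pow, mul_inv_cancel₀ hρ.ne', one_pow, one_mul]
    rw [monom_add, norm_mul, hwm]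
    calc ρ ^ (k + l) * ‖w (k, l) z‖ * ‖monom x' y' z‖
        ≤ ρ ^ (k + l) * ‖w g z‖ * ρ ^ (x' + y') := by
          gcongr
          · exact hmax _ hm
          · exact norm_monom_le hz.le
      _ = _ := by ring

/-- A germ belongs to the ideal iff all monomials of its power series do. -/
theorem scaledMultiplierIdeal_le_iff (hφ : IsToricPsh φ) {c c' : ℝ} :
    scaledMultiplierIdeal φ 0 c ≤ scaledMultiplierIdeal φ 0 c' ↔
      ∀ a b : ℕ, IsMultIntegrable (fun z => (c : EReal) * φ z) 0 (monom a b) →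
        IsMultIntegrable (fun z => (c' : EReal) * φ z) 0 (monom a b) := by
  constructor
  · intro h a b hI
    have hmem : (⟨↑(monom a b), monom a b, analyticAt_monom a b 0, rfl⟩ :
        holGerm (0 : ℂ × ℂ)) ∈ scaledMultiplierIdeal φ 0 c :=
      ⟨monom a b, analyticAt_monom a b 0, rfl, hI⟩
    obtain ⟨u, -, hu, hI'⟩ := h hmem
    exact hφ.isMultIntegrable_congr (analyticAt_monom a b 0) (Germ.coe_eq.1 hu) hI'
  · rintro h _ ⟨u, hu, he, hI⟩
    refine ⟨u, hu, he, ?_⟩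
    obtain ⟨a, ρ, hρ, ha, hs⟩ := hu.exists_double_series
    exact hφ.isMultIntegrable_of_monoms hu hρ ha hs fun α hα =>
      h _ _ (hφ.isMultIntegrable_monom_of_coeff_ne_zero hu hρ ha hs hI hα)

end IsToricPsh

/-! ### Thresholds of an up-closed set in the quadrant -/

/-- Nonempty up-closed subsets of the closed quadrant whose closure omits the origin. -/
structure IsUpperBody (A : Set (ℝ × ℝ)) : Prop where
  nonneg : ∀ a ∈ A, 0 ≤ a.1 ∧ 0 ≤ a.2
  upper : IsUpperSet A
  nonempty : A.Nonempty
  zero_notMem : (0 : ℝ × ℝ) ∉ closure A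

/-- The supremum of the `c` such that `p / c` lies in the diagonal interior of `A`. -/
def threshold (A : Set (ℝ × ℝ)) (p : ℝ × ℝ) : ℝ :=
  sSup {c | 0 < c ∧ (p.1 / c, p.2 / c) ∈ diagInterior A}

/-- The threshold at the positive lattice point `(a + 1, b + 1)`. -/
def latticeThreshold (A : Set (ℝ × ℝ)) (α : ℕ × ℕ) : ℝ :=
  threshold A ((α.1 : ℝ) + 1, (α.2 : ℝ) + 1)

theorem IsUpperSet.diagInterior {A : Set (ℝ × ℝ)} (hA : IsUpperSet A) :
    IsUpperSet (diagInterior A) := by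
  rintro a b hab ⟨ε, hε, h⟩
  exact ⟨ε, hε, hA ⟨sub_le_sub_right hab.1 _, sub_le_sub_right hab.2 _⟩ h⟩

theorem IsUpperSet.diagInterior_subset {A : Set (ℝ × ℝ)} (hA : IsUpperSet A) :
    _root_.diagInterior A ⊆ A := by
  rintro a ⟨ε, hε, h⟩
  exact hA (show (a.1 - ε, a.2 - ε) ≤ a from ⟨by simp [hε.le], by simp [hε.le]⟩) h

theorem IsUpperSet.mem_diagInterior_of_lt {A : Set (ℝ × ℝ)} (hA : IsUpperSet A) {a b : ℝ × ℝ}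
    (ha : a ∈ closure A) (h1 : a.1 < b.1) (h2 : a.2 < b.2) : b ∈ _root_.diagInterior A := by
  set ε := min (b.1 - a.1) (b.2 - a.2) / 2 with hε
  have hm : 0 < min (b.1 - a.1) (b.2 - a.2) := lt_min (by linarith) (by linarith)
  have hε0 : 0 < ε := by positivity
  have e1 := min_le_left (b.1 - a.1) (b.2 - a.2)
  have e2 := min_le_right (b.1 - a.1) (b.2 - a.2)
  have hnhds : Iio (b.1 - ε) ×ˢ Iio (b.2 - ε) ∈ 𝓝 a :=
    (isOpen_Iio.prod isOpen_Iio).mem_nhds ⟨by simp; linarith, by simp; linarith⟩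
  obtain ⟨x, hx, hxA⟩ := mem_closure_iff_nhds.1 ha _ hnhds
  exact ⟨ε, hε0, hA ⟨(mem_Iio.1 hx.1).le, (mem_Iio.1 hx.2).le⟩ hxA⟩

namespace IsUpperBody

variable {A : Set (ℝ × ℝ)}

/-- The admissible `c` form an interval starting at `0`, as `A` is up-closed. It is bounded because
`A` avoids a ball around the origin, and open on the right because part of the room `ε` can be spent
on enlarging `c`. -/
theorem mem_diagInterior_iff (hA : IsUpperBody A) {p : ℝ × ℝ} (h1 : 0 < p.1) (h2 : 0 < p.2) {c : ℝ}
    (hc : 0 < c) : (p.1 / c, p.2 / c) ∈ diagInterior A ↔ c < threshold A p := by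
  set T := {c | 0 < c ∧ (p.1 / c, p.2 / c) ∈ diagInterior A} with hT
  have hbdd : BddAbove T := by
    obtain ⟨r, hr, hball⟩ := Metric.mem_nhds_iff.1
      (isClosed_closure.isOpen_compl.mem_nhds (show (0 : ℝ × ℝ) ∈ (closure A)ᶜ from hA.zero_notMem))
    refine ⟨max p.1 p.2 / r, ?_⟩
    rintro c ⟨hc, hmem⟩
    have h3 : (p.1 / c, p.2 / c) ∉ Metric.ball (0 : ℝ × ℝ) r := fun h =>
      hball h (subset_closure (hA.upper.diagInterior_subset hmem))
    rw [mem_ball_zero_iff, Prod.norm_def, not_lt, Real.norm_of_nonneg (by positivity),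
      Real.norm_of_nonneg (by positivity), max_div_div_right hc.le, le_div_iff₀ hc] at h3
    rw [le_div_iff₀ hr]
    linarith
  constructor
  · rintro ⟨ε, hε, hmem⟩
    have hcont : ∀ x : ℝ, ∀ᶠ d in 𝓝[>] c, x / c - ε / 2 < x / d := fun x => by
      have : ContinuousAt (fun d : ℝ => x / d) c := continuousAt_const.div continuousAt_id hc.ne'
      exact (this.eventually_const_lt (by linarith)).filter_mono nhdsWithin_le_nhds
    obtain ⟨d, hd1, hd2, hd⟩ := ((hcont p.1).and ((hcont p.2).and self_mem_nhdsWithin)).exists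
    have hd : c < d := hd
    refine hd.trans_le (le_csSup hbdd ⟨hc.trans hd, ε / 2, by positivity, ?_⟩)
    exact hA.upper ⟨by simp only; linarith, by simp only; linarith⟩ hmem
  · intro hlt
    have hne : T.Nonempty := by
      obtain ⟨a, ha⟩ := hA.nonempty
      obtain ⟨a1, a2⟩ := hA.nonneg a ha
      set d := min (p.1 / (a.1 + 1)) (p.2 / (a.2 + 1)) with hd
      have hd0 : 0 < d := lt_min (by positivity) (by positivity)
      refine ⟨d, hd0, hA.upper.mem_diagInterior_of_lt (subset_closure ha) ?_ ?_⟩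
      · have : d ≤ p.1 / (a.1 + 1) := min_le_left _ _
        rw [le_div_iff₀ (by positivity)] at this
        simp only
        rw [lt_div_iff₀ hd0]
        nlinarith
      · have : d ≤ p.2 / (a.2 + 1) := min_le_right _ _
        rw [le_div_iff₀ (by positivity)] at this
        simp only
        rw [lt_div_iff₀ hd0]
        nlinarith
    obtain ⟨d, ⟨hd0, hd⟩, hcd⟩ := exists_lt_of_lt_csSup hne hlt
    exact hA.upper.diagInterior ⟨div_le_div_of_nonneg_left h1.le hc hcd.le,
      div_le_div_of_nonneg_left h2.le hc hcd.le⟩ hd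

theorem threshold_pos (hA : IsUpperBody A) {p : ℝ × ℝ} (h1 : 0 < p.1) (h2 : 0 < p.2) :
    0 < threshold A p := by
  obtain ⟨a, ha⟩ := hA.nonempty
  obtain ⟨a1, a2⟩ := hA.nonneg a ha
  set d := min (p.1 / (a.1 + 1)) (p.2 / (a.2 + 1)) with hd
  have hd0 : 0 < d := lt_min (by positivity) (by positivity)
  refine hd0.trans ((hA.mem_diagInterior_iff h1 h2 hd0).1
    (hA.upper.mem_diagInterior_of_lt (subset_closure ha) ?_ ?_))
  · have : d ≤ p.1 / (a.1 + 1) := min_le_left _ _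
    rw [le_div_iff₀ (by positivity)] at this
    simp only
    rw [lt_div_iff₀ hd0]
    nlinarith
  · have : d ≤ p.2 / (a.2 + 1) := min_le_right _ _
    rw [le_div_iff₀ (by positivity)] at this
    simp only
    rw [lt_div_iff₀ hd0]
    nlinarith

theorem threshold_mono (hA : IsUpperBody A) {p q : ℝ × ℝ} (h1 : 0 < p.1) (h2 : 0 < p.2)
    (hpq : p ≤ q) : threshold A p ≤ threshold A q := by
  have q1 : 0 < q.1 := h1.trans_le hpq.1
  have q2 : 0 < q.2 := h2.trans_le hpq.2
  by_contra! hlt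
  have h0 := hA.threshold_pos q1 q2
  have := (hA.mem_diagInterior_iff h1 h2 h0).2 hlt
  exact lt_irrefl _ ((hA.mem_diagInterior_iff q1 q2 h0).1 (hA.upper.diagInterior
    ⟨div_le_div_of_nonneg_right hpq.1 h0.le, div_le_div_of_nonneg_right hpq.2 h0.le⟩ this))

/-- Thresholds scale linearly and `p ≥ (m, m)`. -/
theorem mul_threshold_le (hA : IsUpperBody A) {p : ℝ × ℝ} {m : ℝ} (hm : 0 < m) (h1 : m ≤ p.1)
    (h2 : m ≤ p.2) : m * threshold A (1, 1) ≤ threshold A p := by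
  have p1 : 0 < p.1 := hm.trans_le h1
  have p2 : 0 < p.2 := hm.trans_le h2
  by_contra! hlt
  have h0 := hA.threshold_pos p1 p2
  have h3 : threshold A p / m < threshold A (1, 1) := by
    rw [div_lt_iff₀ hm]
    linarith
  have := (hA.mem_diagInterior_iff (p := (1, 1)) one_pos one_pos (by positivity)).2 h3
  refine lt_irrefl _ ((hA.mem_diagInterior_iff p1 p2 h0).1 (hA.upper.diagInterior ⟨?_, ?_⟩ this))
  · simp only [one_div_div]
    gcongr
  · simp only [one_div_div]
    gcongr

theorem latticeThreshold_pos (hA : IsUpperBody A) (α : ℕ × ℕ) : 0 < latticeThreshold A α :=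
  hA.threshold_pos (by positivity) (by positivity)

theorem monotone_latticeThreshold (hA : IsUpperBody A) : Monotone (latticeThreshold A) := by
  intro α β h
  refine hA.threshold_mono (by positivity) (by positivity) ⟨?_, ?_⟩
  · have : (α.1 : ℝ) ≤ β.1 := by exact_mod_cast h.1
    simpa using this
  · have : (α.2 : ℝ) ≤ β.2 := by exact_mod_cast h.2
    simpa using this

theorem lt_latticeThreshold_iff (hA : IsUpperBody A) {c : ℝ} (hc : 0 < c) {a b : ℕ} :
    c < latticeThreshold A (a, b) ↔ (((a : ℝ) + 1) / c, ((b : ℝ) + 1) / c) ∈ diagInterior A :=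
  (hA.mem_diagInterior_iff (p := ((a : ℝ) + 1, (b : ℝ) + 1)) (by positivity) (by positivity) hc).symm

/-- Confines the thresholds below a given bound to finitely many rows and columns. -/
theorem exists_latticeThreshold_gt (hA : IsUpperBody A) (x : ℝ) :
    ∃ K : ℕ, ∀ a b : ℕ, K ≤ a → K ≤ b → x < latticeThreshold A (a, b) := by
  have h0 := hA.threshold_pos (p := (1, 1)) one_pos one_pos
  obtain ⟨K, hK⟩ := exists_nat_gt (x / threshold A (1, 1))
  refine ⟨K, fun a b ha hb => ?_⟩
  rw [div_lt_iff₀ h0] at hK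
  have ha' : (K : ℝ) ≤ a := by exact_mod_cast ha
  have hb' : (K : ℝ) ≤ b := by exact_mod_cast hb
  have := hA.mul_threshold_le (p := ((a : ℝ) + 1, (b : ℝ) + 1)) (m := K + 1) (by positivity)
    (by simpa using ha') (by simpa using hb')
  refine lt_of_lt_of_le ?_ this
  linarith

/-! ### Rows -/

theorem sInf_fst_le (hA : IsUpperBody A) {a : ℝ × ℝ} (ha : a ∈ closure A) :
    sInf (Prod.fst '' closure A) ≤ a.1 := by
  refine csInf_le ⟨0, ?_⟩ ⟨a, ha, rfl⟩
  rintro _ ⟨b, hb, rfl⟩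
  have hsub : closure A ⊆ {x | 0 ≤ x.1} :=
    closure_minimal (fun x hx => (hA.nonneg x hx).1) (isClosed_le continuous_const continuous_fst)
  exact hsub hb

/-- A large `b` makes the second coordinate harmless, so only `(a+1)/c > x₀` remains. -/
theorem exists_lt_latticeThreshold_iff (hA : IsUpperBody A) {c : ℝ} (hc : 0 < c) (a : ℕ) :
    (∃ b, c < latticeThreshold A (a, b)) ↔ c * sInf (Prod.fst '' closure A) < a + 1 := by
  rw [mul_comm, ← lt_div_iff₀ hc]
  constructor
  · rintro ⟨b, hb⟩
    obtain ⟨ε, hε, h⟩ := (hA.lt_latticeThreshold_iff hc).1 hb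
    have := hA.sInf_fst_le (subset_closure h)
    simp only at this
    linarith
  · intro hlt
    obtain ⟨_, ⟨x, hx, rfl⟩, hxlt⟩ := exists_lt_of_csInf_lt (hA.nonempty.closure.image _) hlt
    obtain ⟨b, hb⟩ := exists_nat_gt (x.2 * c)
    refine ⟨b, (hA.lt_latticeThreshold_iff hc).2 (hA.upper.mem_diagInterior_of_lt hx hxlt ?_)⟩
    rw [lt_div_iff₀ hc]
    linarith

theorem isLUB_row_iff (hA : IsUpperBody A) (a : ℕ) {x : ℝ} :
    IsLUB (range fun b => latticeThreshold A (a, b)) x ↔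
      0 < sInf (Prod.fst '' closure A) ∧ x = (a + 1) / sInf (Prod.fst '' closure A) := by
  set x0 := sInf (Prod.fst '' closure A) with hx0
  have key := fun c hc => hA.exists_lt_latticeThreshold_iff (c := c) hc a
  rw [← hx0] at key
  constructor
  · intro h
    have hxpos : 0 < x := (hA.latticeThreshold_pos (a, 0)).trans_le (h.1 ⟨0, rfl⟩)
    have h1 : (a : ℝ) + 1 ≤ x * x0 := by
      by_contra! hlt
      obtain ⟨b, hb⟩ := (key x hxpos).2 hlt
      exact hb.not_ge (h.1 ⟨b, rfl⟩)
    have hpos : 0 < x0 := by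
      by_contra! hle
      nlinarith
    refine ⟨hpos, le_antisymm ?_ ((div_le_iff₀ hpos).2 h1)⟩
    by_contra! hlt
    have hc : (0 : ℝ) < (a + 1) / x0 := by positivity
    obtain ⟨_, ⟨b, rfl⟩, hb⟩ := (lt_isLUB_iff h).1 hlt
    have := (key _ hc).1 ⟨b, hb⟩
    rw [div_mul_cancel₀ _ hpos.ne'] at this
    exact lt_irrefl _ this
  · rintro ⟨hpos, rfl⟩
    have hc : (0 : ℝ) < (a + 1) / x0 := by positivity
    refine ⟨?_, fun y hy => ?_⟩
    · rintro _ ⟨b, rfl⟩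
      by_contra! hlt
      have := (key _ hc).1 ⟨b, hlt⟩
      rw [div_mul_cancel₀ _ hpos.ne'] at this
      exact lt_irrefl _ this
    · by_contra! hlt
      have hy0 : 0 < y := (hA.latticeThreshold_pos (a, 0)).trans_le (hy ⟨0, rfl⟩)
      rw [lt_div_iff₀ hpos] at hlt
      obtain ⟨b, hb⟩ := (key y hy0).2 hlt
      exact hb.not_ge (hy ⟨b, rfl⟩)

/-- If the supremum `c0` is attained at `b`, the points `(a+1, b+1)/c` with `c` increasing to `c0`
lie in `A` and tend to the line `x = x₀`. Conversely, given a point of the closure on that line,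
choose `b` with `(b+1)/c0` above it: a threshold below `c0` would contradict its own maximality. -/
theorem mem_row_iff (hA : IsUpperBody A) (a : ℕ) (hpos : 0 < sInf (Prod.fst '' closure A)) :
    ((a : ℝ) + 1) / sInf (Prod.fst '' closure A) ∈ range (fun b => latticeThreshold A (a, b)) ↔
      ∃ y, (sInf (Prod.fst '' closure A), y) ∈ closure A := by
  have hlub := (hA.isLUB_row_iff a).2 ⟨hpos, rfl⟩
  set x0 := sInf (Prod.fst '' closure A) with hx0
  set c0 := ((a : ℝ) + 1) / x0 with hc0
  have hc : 0 < c0 := by positivity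
  have hac : ((a : ℝ) + 1) / c0 = x0 := by rw [hc0]; field_simp
  constructor
  · rintro ⟨b, hb⟩
    simp only at hb
    refine ⟨((b : ℝ) + 1) / c0, ?_⟩
    have hlim : Tendsto (fun c : ℝ => (((a : ℝ) + 1) / c, ((b : ℝ) + 1) / c)) (𝓝[<] c0)
        (𝓝 (x0, ((b : ℝ) + 1) / c0)) := by
      have : ContinuousAt (fun c : ℝ => (((a : ℝ) + 1) / c, ((b : ℝ) + 1) / c)) c0 :=
        (continuousAt_const.div continuousAt_id hc.ne').prodMk
          (continuousAt_const.div continuousAt_id hc.ne')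
      have h2 := this.tendsto
      rw [hac] at h2
      exact h2.mono_left nhdsWithin_le_nhds
    refine mem_closure_of_tendsto hlim ?_
    have hev : ∀ᶠ c in 𝓝[<] c0, 0 < c := (eventually_gt_nhds hc).filter_mono nhdsWithin_le_nhds
    filter_upwards [hev, self_mem_nhdsWithin] with c h1 h2
    exact hA.upper.diagInterior_subset ((hA.lt_latticeThreshold_iff h1).1 (hb ▸ h2))
  · rintro ⟨y, hy⟩
    obtain ⟨b, hb⟩ := exists_nat_gt (y * c0)
    refine ⟨b, le_antisymm (hlub.1 ⟨b, rfl⟩) ?_⟩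
    by_contra! hlt
    replace hlt : latticeThreshold A (a, b) < c0 := hlt
    have h0 := hA.latticeThreshold_pos (a, b)
    refine lt_irrefl _ ((hA.lt_latticeThreshold_iff h0).2 (hA.upper.mem_diagInterior_of_lt hy ?_ ?_))
    · rw [← hac]
      exact div_lt_div_of_pos_left (by positivity) h0 hlt
    · calc y < (b + 1) / c0 := by
            rw [lt_div_iff₀ hc]
            linarith
        _ ≤ _ := div_le_div_of_nonneg_left (by positivity) h0 hlt.le

end IsUpperBody

/-- If the sequence passes or attains `x`, some neighbourhood of `x` contains only finitely many
values other than `x`. An unattained supremum is in the closure of the range but not in the range.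
-/
theorem Monotone.accPt_range_iff {s : ℕ → ℝ} (hs : Monotone s) {x : ℝ} :
    AccPt x (𝓟 (range s)) ↔ IsLUB (range s) x ∧ x ∉ range s := by
  constructor
  · intro h
    rw [accPt_iff_nhds] at h
    have hno : ∀ (n : ℕ) (U : Set ℝ), U ∈ 𝓝 x → (∀ y ∈ U ∩ range s, y ≠ x → y ∈ s '' Iio n) → False := by
      intro n U hU hsub
      have hf : (s '' Iio n \ {x}).Finite := ((finite_Iio n).image s).sdiff
      have hc : (s '' Iio n \ {x})ᶜ ∈ 𝓝 x := hf.isClosed.isOpen_compl.mem_nhds (by simp)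
      obtain ⟨y, ⟨⟨hyU, hyc⟩, hys⟩, hyx⟩ := h _ (inter_mem hU hc)
      exact hyc ⟨hsub y ⟨hyU, hys⟩ hyx, hyx⟩
    have hub : ∀ n, s n ≤ x := by
      intro n
      by_contra! hlt
      refine hno n (Iio (s n)) (Iio_mem_nhds hlt) ?_
      rintro _ ⟨hy, m, rfl⟩ -
      refine ⟨m, ?_, rfl⟩
      by_contra hm
      exact (mem_Iio.1 hy).not_ge (hs (not_lt.1 hm))
    refine ⟨⟨by rintro _ ⟨n, rfl⟩; exact hub n, fun y hy => ?_⟩, ?_⟩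
    · by_contra! hlt
      obtain ⟨_, ⟨hz, n, rfl⟩, -⟩ := h _ (Ioi_mem_nhds hlt)
      exact (mem_Ioi.1 hz).not_ge (hy ⟨n, rfl⟩)
    · rintro ⟨n, hn⟩
      refine hno n univ univ_mem ?_
      rintro _ ⟨-, m, rfl⟩ hne
      refine ⟨m, ?_, rfl⟩
      by_contra hm
      exact hne (le_antisymm (hub m) (hn ▸ hs (not_lt.1 hm)))
  · rintro ⟨hl, hx⟩
    rw [accPt_iff_nhds]
    intro U hU
    obtain ⟨y, hyU, hys⟩ := mem_closure_iff_nhds.1 (hl.mem_closure (range_nonempty s)) U hU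
    exact ⟨y, ⟨hyU, hys⟩, fun h => hx (h ▸ hys)⟩

/-! ### Accumulation points of the set of thresholds -/

namespace IsUpperBody

variable {A : Set (ℝ × ℝ)}

theorem accPt_row_iff (hA : IsUpperBody A) (a : ℕ) {x : ℝ} :
    AccPt x (𝓟 (range fun b => latticeThreshold A (a, b))) ↔
      0 < sInf (Prod.fst '' closure A) ∧ (∀ y, (sInf (Prod.fst '' closure A), y) ∉ closure A) ∧
        x = (a + 1) / sInf (Prod.fst '' closure A) := by
  have hm : Monotone fun b => latticeThreshold A (a, b) :=
    fun b b' h => hA.monotone_latticeThreshold ⟨le_rfl, h⟩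
  rw [hm.accPt_range_iff, hA.isLUB_row_iff]
  constructor
  · rintro ⟨⟨hpos, rfl⟩, h⟩
    rw [hA.mem_row_iff a hpos, not_exists] at h
    exact ⟨hpos, h, rfl⟩
  · rintro ⟨hpos, h, rfl⟩
    refine ⟨⟨hpos, rfl⟩, ?_⟩
    rw [hA.mem_row_iff a hpos, not_exists]
    exact h

theorem closure_swap (A : Set (ℝ × ℝ)) : closure (Prod.swap ⁻¹' A) = Prod.swap ⁻¹' closure A :=
  ((Homeomorph.prodComm ℝ ℝ).preimage_closure A).symm

theorem swap (hA : IsUpperBody A) : IsUpperBody (Prod.swap ⁻¹' A) where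
  nonneg := fun a ha => (hA.nonneg _ ha).symm
  upper := fun a b hab ha => hA.upper (show a.swap ≤ b.swap from ⟨hab.2, hab.1⟩) ha
  nonempty := by
    obtain ⟨a, ha⟩ := hA.nonempty
    exact ⟨a.swap, by simpa using ha⟩
  zero_notMem := by
    rw [closure_swap]
    exact hA.zero_notMem

theorem latticeThreshold_swap (A : Set (ℝ × ℝ)) (a b : ℕ) :
    latticeThreshold (Prod.swap ⁻¹' A) (b, a) = latticeThreshold A (a, b) := rfl

theorem accPt_col_iff (hA : IsUpperBody A) (b : ℕ) {x : ℝ} :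
    AccPt x (𝓟 (range fun a => latticeThreshold A (a, b))) ↔
      0 < sInf (Prod.snd '' closure A) ∧ (∀ y, (y, sInf (Prod.snd '' closure A)) ∉ closure A) ∧
        x = (b + 1) / sInf (Prod.snd '' closure A) := by
  have h := hA.swap.accPt_row_iff b (x := x)
  have himg : Prod.fst '' closure (Prod.swap ⁻¹' A) = Prod.snd '' closure A := by
    rw [closure_swap]
    ext y
    constructor
    · rintro ⟨z, hz, rfl⟩
      exact ⟨z.swap, hz, rfl⟩
    · rintro ⟨z, hz, rfl⟩
      exact ⟨z.swap, by simpa using hz, rfl⟩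
  rw [himg] at h
  simpa only [closure_swap, latticeThreshold_swap, mem_preimage, Prod.swap_prod_mk] using h

/-- Near `x` only finitely many rows and columns contribute, and an accumulation point of a finite
union is one of some member. -/
theorem accPt_range_latticeThreshold_iff (hA : IsUpperBody A) {x : ℝ} :
    AccPt x (𝓟 (range (latticeThreshold A))) ↔
      (∃ a : ℕ, AccPt x (𝓟 (range fun b => latticeThreshold A (a, b)))) ∨
        ∃ b : ℕ, AccPt x (𝓟 (range fun a => latticeThreshold A (a, b))) := by
  constructor
  · intro h
    by_contra! hcon
    obtain ⟨h1, h2⟩ := hcon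
    obtain ⟨K, hK⟩ := hA.exists_latticeThreshold_gt (x + 1)
    simp only [accPt_iff_frequently_nhdsNE, not_frequently] at h1 h2
    have e1 : ∀ᶠ y in 𝓝[≠] x, ∀ a ∈ Finset.range K, y ∉ range fun b => latticeThreshold A (a, b) :=
      (Finset.eventually_all _).2 fun a _ => h1 a
    have e2 : ∀ᶠ y in 𝓝[≠] x, ∀ b ∈ Finset.range K, y ∉ range fun a => latticeThreshold A (a, b) :=
      (Finset.eventually_all _).2 fun b _ => h2 b
    have e3 : ∀ᶠ y in 𝓝[≠] x, y < x + 1 :=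
      (eventually_lt_nhds (by linarith)).filter_mono nhdsWithin_le_nhds
    obtain ⟨y, ⟨⟨a, b⟩, rfl⟩, q1, q2, q3⟩ :=
      ((accPt_iff_frequently_nhdsNE.1 h).and_eventually (e1.and (e2.and e3))).exists
    refine q3.not_gt (hK a b ?_ ?_)
    · by_contra! hlt
      exact q1 a (Finset.mem_range.2 hlt) ⟨b, rfl⟩
    · by_contra! hlt
      exact q2 b (Finset.mem_range.2 hlt) ⟨a, rfl⟩
  · rintro (⟨a, h⟩ | ⟨b, h⟩)
    · refine h.mono (principal_mono.2 ?_)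
      rintro _ ⟨b, rfl⟩
      exact ⟨(a, b), rfl⟩
    · refine h.mono (principal_mono.2 ?_)
      rintro _ ⟨a, rfl⟩
      exact ⟨(a, b), rfl⟩

/-- The monotone image of the well-quasi-order `ℕ × ℕ` is well-founded, so thresholds never
accumulate from above. This yields the `δ` in the definition of a jumping number. -/
theorem exists_next_latticeThreshold (hA : IsUpperBody A) (x : ℝ) :
    ∃ y ∈ range (latticeThreshold A), x < y ∧ ∀ z ∈ range (latticeThreshold A), x < z → y ≤ z := by
  have hpwo : (range (latticeThreshold A)).IsPWO := by
    rw [← image_univ]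
    exact (isPWO_of_wellQuasiOrderedLE univ).image_of_monotone hA.monotone_latticeThreshold
  set S := {y | y ∈ range (latticeThreshold A) ∧ x < y} with hS
  have hwf : S.IsWF := hpwo.isWF.mono fun y hy => hy.1
  have hne : S.Nonempty := by
    obtain ⟨K, hK⟩ := hA.exists_latticeThreshold_gt x
    exact ⟨_, ⟨(K, K), rfl⟩, hK K K le_rfl le_rfl⟩
  obtain ⟨h1, h2⟩ := hwf.min_mem hne
  exact ⟨hwf.min hne, h1, h2, fun z hz hxz => hwf.min_le hne ⟨hz, hxz⟩⟩

end IsUpperBody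

/-! ### Jumping numbers of toric plurisubharmonic functions -/

theorem newtonBody_eq (φ : ℂ × ℂ → EReal) : newtonBody φ = closure (linearMinorants φ) := rfl

namespace IsToricPsh

variable {φ : ℂ × ℂ → EReal}

theorem isUpperSet_linearMinorants (hφ : IsToricPsh φ) : IsUpperSet (linearMinorants φ) := by
  intro a b hab ha
  obtain ⟨h1, h2, C, hC⟩ := hφ.mem_linearMinorants.1 ha
  refine hφ.mem_linearMinorants.2 ⟨h1.trans hab.1, h2.trans hab.2, C, fun t ht => ?_⟩
  have t1 : t.1 < 0 := ht.1
  have t2 : t.2 < 0 := ht.2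
  have := hC t ht
  nlinarith [mul_le_mul_of_nonpos_right hab.1 t1.le, mul_le_mul_of_nonpos_right hab.2 t2.le]

theorem scaledMultiplierIdeal_le_iff_diagInterior (hφ : IsToricPsh φ) {c c' : ℝ} (hc : 0 < c)
    (hc' : 0 < c') : scaledMultiplierIdeal φ 0 c ≤ scaledMultiplierIdeal φ 0 c' ↔
      ∀ a b : ℕ, (((a : ℝ) + 1) / c, ((b : ℝ) + 1) / c) ∈ diagInterior (linearMinorants φ) →
        (((a : ℝ) + 1) / c', ((b : ℝ) + 1) / c') ∈ diagInterior (linearMinorants φ) := by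
  rw [hφ.scaledMultiplierIdeal_le_iff]
  simp only [hφ.isMultIntegrable_monom_iff hc, hφ.isMultIntegrable_monom_iff hc']

theorem scaledMultiplierIdeal_le_iff_threshold (hφ : IsToricPsh φ)
    (hA : IsUpperBody (linearMinorants φ)) {c c' : ℝ} (hc : 0 < c) (hc' : 0 < c') :
    scaledMultiplierIdeal φ 0 c ≤ scaledMultiplierIdeal φ 0 c' ↔
      ∀ x ∈ range (latticeThreshold (linearMinorants φ)), c < x → c' < x := by
  rw [hφ.scaledMultiplierIdeal_le_iff_diagInterior hc hc']
  simp only [← hA.lt_latticeThreshold_iff hc, ← hA.lt_latticeThreshold_iff hc', forall_mem_range,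
    Prod.forall]

/-- The ideal is constant from a threshold up to the next one, `y`; it changes at `x` and at `y`
because the sets of thresholds above `c` change there. -/
theorem range_subset_jumpingNumbers (hφ : IsToricPsh φ) (hA : IsUpperBody (linearMinorants φ)) :
    range (latticeThreshold (linearMinorants φ)) ⊆ jumpingNumbers φ 0 := by
  intro x hx
  have hx0 : 0 < x := by
    obtain ⟨α, rfl⟩ := hx
    exact hA.latticeThreshold_pos α
  have hle := fun {c c' : ℝ} => hφ.scaledMultiplierIdeal_le_iff_threshold hA (c := c) (c' := c')
  obtain ⟨y, hy, hxy, hmin⟩ := hA.exists_next_latticeThreshold x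
  refine ⟨hx0, y - x, sub_pos.2 hxy, fun c hc => ?_, ?_⟩
  · rw [add_sub_cancel, le_antisymm_iff, hle hc hx0, hle hx0 hc]
    constructor
    · rintro ⟨h1, h2⟩
      exact ⟨not_lt.1 fun h => lt_irrefl _ (h1 x hx h), h2 y hy hxy⟩
    · rintro ⟨h1, h2⟩
      exact ⟨fun z _ hz => h1.trans_lt hz, fun z hz hxz => h2.trans_le (hmin z hz hxz)⟩
  · have hy0 := hx0.trans hxy
    rw [add_sub_cancel, lt_iff_le_not_ge, hle hy0 hx0, hle hx0 hy0]
    exact ⟨fun z _ hz => hxy.trans hz, fun h => lt_irrefl _ (h y hy hxy)⟩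

/-- If no threshold is near `x`, the ideal is the same slightly to the left of `x`, so `x` is not
the left end of its interval. -/
theorem jumpingNumbers_subset_closure (hφ : IsToricPsh φ) (hA : IsUpperBody (linearMinorants φ)) :
    jumpingNumbers φ 0 ⊆ closure (range (latticeThreshold (linearMinorants φ))) := by
  rintro x ⟨hx0, δ, hδ, hiff, -⟩
  by_contra hcl
  obtain ⟨ε, hε, hball⟩ := Metric.mem_nhds_iff.1 (isClosed_closure.isOpen_compl.mem_nhds hcl)
  set c := max (x / 2) (x - ε / 2) with hc
  have hc0 : 0 < c := lt_max_of_lt_left (by positivity)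
  have hcx : c < x := max_lt (by linarith) (by linarith)
  have hcε : x - ε / 2 ≤ c := le_max_right _ _
  refine hcx.not_ge ((hiff c hc0).1 (le_antisymm ?_ ?_)).1
  · rw [hφ.scaledMultiplierIdeal_le_iff_threshold hA hc0 hx0]
    intro y hy hcy
    by_contra! hyx
    refine hball ?_ (subset_closure hy)
    rw [Metric.mem_ball, Real.dist_eq, abs_lt]
    constructor <;> linarith
  · rw [hφ.scaledMultiplierIdeal_le_iff_threshold hA hx0 hc0]
    exact fun y _ h => hcx.trans h

/-- Passing to the closure creates no new accumulation points, so the jumping numbers need not be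
known exactly. -/
theorem clusterPoints_eq_derivedSet (hφ : IsToricPsh φ) (hA : IsUpperBody (linearMinorants φ)) :
    clusterPoints (jumpingNumbers φ 0) =
      derivedSet (range (latticeThreshold (linearMinorants φ))) := by
  refine subset_antisymm ?_ (derivedSet_mono _ _ (hφ.range_subset_jumpingNumbers hA))
  rw [← derivedSet_closure]
  exact derivedSet_mono _ _ (hφ.jumpingNumbers_subset_closure hA)

theorem clusterPoints_eq (hφ : IsToricPsh φ) : clusterPoints (jumpingNumbers φ 0) =
    {c : ℝ | ∃ k : ℤ, 0 < k ∧ ∃ m ∈ asymptoteSet φ, c = (k : ℝ) / m} := by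
  have hup := hφ.isUpperSet_linearMinorants
  have hV : VerticalCondition φ ↔ 0 < asymptoteX φ ∧
      ∀ y, (asymptoteX φ, y) ∉ closure (linearMinorants φ) := by
    refine and_congr_right fun _ => ?_
    rw [eq_empty_iff_forall_notMem]
    exact ⟨fun h y hy => h _ ⟨rfl, hy⟩, fun h p ⟨h1, h2⟩ => h p.2 (h1 ▸ h2)⟩
  have hH : HorizontalCondition φ ↔ 0 < asymptoteY φ ∧
      ∀ y, (y, asymptoteY φ) ∉ closure (linearMinorants φ) := by
    refine and_congr_right fun _ => ?_
    rw [eq_empty_iff_forall_notMem]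
    exact ⟨fun h y hy => h _ ⟨rfl, hy⟩, fun h p ⟨h1, h2⟩ => h p.1 (h1 ▸ h2)⟩
  have hnn : ∀ p ∈ closure (linearMinorants φ), 0 ≤ p.1 ∧ 0 ≤ p.2 := fun p hp =>
    closure_minimal (t := {x : ℝ × ℝ | 0 ≤ x.1 ∧ 0 ≤ x.2}) (fun x hx => ⟨hx.1, hx.2.1⟩)
      ((isClosed_le continuous_const continuous_fst).inter
        (isClosed_le continuous_const continuous_snd)) hp
  by_cases hA : IsUpperBody (linearMinorants φ)
  · rw [hφ.clusterPoints_eq_derivedSet hA]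
    ext x
    rw [mem_derivedSet, hA.accPt_range_latticeThreshold_iff]
    simp only [hA.accPt_row_iff, hA.accPt_col_iff]
    constructor
    · rintro (⟨a, h1, h2, rfl⟩ | ⟨a, h1, h2, rfl⟩)
      · exact ⟨a + 1, by positivity, _, Or.inl ⟨rfl, hV.2 ⟨h1, h2⟩⟩, by push_cast; rfl⟩
      · exact ⟨a + 1, by positivity, _, Or.inr ⟨rfl, hH.2 ⟨h1, h2⟩⟩, by push_cast; rfl⟩
    · rintro ⟨k, hk, m, hm, rfl⟩
      -- The integer `k` corresponds to row or column `k - 1`, because of the shift in `(a+1, b+1)`.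
      obtain ⟨a, rfl⟩ : ∃ a : ℕ, k = a + 1 := ⟨(k - 1).toNat, by omega⟩
      rcases hm with ⟨rfl, h⟩ | ⟨rfl, h⟩
      · obtain ⟨h1, h2⟩ := hV.1 h
        exact Or.inl ⟨a, h1, h2, by push_cast; rfl⟩
      · obtain ⟨h1, h2⟩ := hH.1 h
        exact Or.inr ⟨a, h1, h2, by push_cast; rfl⟩
  · have hdeg : linearMinorants φ = ∅ ∨ (0 : ℝ × ℝ) ∈ closure (linearMinorants φ) := by
      by_contra! h
      exact hA ⟨fun a ha => ⟨ha.1, ha.2.1⟩, hup, h.1, h.2⟩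
    have hle : ∀ c c' : ℝ, 0 < c → 0 < c' →
        scaledMultiplierIdeal φ 0 c ≤ scaledMultiplierIdeal φ 0 c' := by
      intro c c' hc hc'
      rw [hφ.scaledMultiplierIdeal_le_iff_diagInterior hc hc']
      rcases hdeg with h | h
      · simp [h, diagInterior]
      · exact fun a b _ => hup.mem_diagInterior_of_lt h (by simp; positivity) (by simp; positivity)
    have hJ : jumpingNumbers φ 0 = ∅ := by
      rw [eq_empty_iff_forall_notMem]
      rintro x ⟨hx, δ, hδ, -, hlt⟩
      exact hlt.not_ge (hle _ _ hx (by linarith))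
    -- For an empty body the infima are `sInf ∅ = 0`, so neither condition can hold.
    have hXY : asymptoteX φ ≤ 0 ∧ asymptoteY φ ≤ 0 := by
      rw [asymptoteX, asymptoteY, newtonBody_eq]
      rcases hdeg with h | h
      · simp [h]
      · constructor
        · exact csInf_le ⟨0, by rintro _ ⟨p, hp, rfl⟩; exact (hnn p hp).1⟩ ⟨0, h, rfl⟩
        · exact csInf_le ⟨0, by rintro _ ⟨p, hp, rfl⟩; exact (hnn p hp).2⟩ ⟨0, h, rfl⟩
    have hS : asymptoteSet φ = ∅ := by
      rw [eq_empty_iff_forall_notMem]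
      rintro m (⟨-, h⟩ | ⟨-, h⟩)
      · exact hXY.1.not_gt h.1
      · exact hXY.2.not_gt h.1
    rw [hJ, hS]
    ext x
    simp [clusterPoints, AccPt]

end IsToricPsh

end

theorem theorem5p4 (φ : ℂ × ℂ → EReal) (hφ : IsToricPsh φ) :
    ((clusterPoints (jumpingNumbers φ 0)).Nonempty ↔
      VerticalCondition φ ∨ HorizontalCondition φ) ∧
    ((clusterPoints (jumpingNumbers φ 0)).Nonempty →
      (clusterPoints (jumpingNumbers φ 0)).Infinite) ∧
    clusterPoints (jumpingNumbers φ 0) =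
      {c : ℝ | ∃ k : ℤ, 0 < k ∧ ∃ m ∈ asymptoteSet φ, c = (k : ℝ) / m} := by
  have heq := hφ.clusterPoints_eq
  refine ⟨?_, ?_, heq⟩
  · rw [heq]
    constructor
    · rintro ⟨_, k, -, m, ⟨-, h⟩ | ⟨-, h⟩, -⟩
      · exact Or.inl h
      · exact Or.inr h
    · rintro (h | h)
      · exact ⟨_, 1, one_pos, _, Or.inl ⟨rfl, h⟩, rfl⟩
      · exact ⟨_, 1, one_pos, _, Or.inr ⟨rfl, h⟩, rfl⟩
  · rw [heq]
    rintro ⟨_, -, -, m, hm, -⟩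
    have hm0 : m ≠ 0 := by
      rcases hm with ⟨rfl, h⟩ | ⟨rfl, h⟩
      · exact h.1.ne'
      · exact h.1.ne'
    refine (infinite_range_of_injective (f := fun a : ℕ => (((a : ℤ) + 1 : ℤ) : ℝ) / m) ?_).mono ?_
    · intro a b hab
      simpa [div_left_inj' hm0] using hab
    · rintro _ ⟨a, rfl⟩
      exact ⟨a + 1, by positivity, m, hm, rfl⟩
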